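/- Let $\mathcal H$ be a complex Hilbert space (inner products linear in the second variable), write $|x\rangle\langle y|$ for the operator $v\mapsto\langle y,v\rangle x$, and let the $\sigma$-weak topology on $\mathcal B(\mathcal H)$ be the one generated by the functionals $A\mapsto\sum_n\langle x_n,Ay_n\rangle$ with $\sum_n\|x_n\|^2<\infty$, $\sum_n\|y_n\|^2<\infty$. Let $(T_t)_{t\ge0}$ be a quantum Markov semigroup on $\mathcal B(\mathcal H)$, i.e. a family of $\sigma$-weakly continuous completely positive linear maps with $T_0=\mathrm{id}$, $T_{t+s}=T_tT_s$, $T_t(1)=1$ and $t\mapsto T_t(A)$ $\sigma$-weakly continuous for every $A$. Let $L$ be its generator: $D(L)$ is the set of $A$ for which $\frac1t(T_tA-A)$ converges $\sigma$-weakly as $t\downarrow0$, and $L(A)$ is the limit. Let $$\mathcal A=\{A\in D(L): A^*A\in D(L),\ AA^*\in D(L)\}$$ be the domain algebra of $L$ (the largest $^*$-subalgebra of $\mathcal B(\mathcal H)$ contained in $D(L)$). Let $R\in D(L)$ be a nonzero positive finite rank operator and let $h$ be an associate vector of $R$: for some spectral decomposition $R=\sum_{s=1}^m t_s'|k_s'\rangle\langle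 k_s'|$ with $(k'_s)$ orthonormal and $t'_s>0$, put $t=\sum_s t'_s$ and $k_s=\sqrt t\,k'_s$; then $h=\sum_{s=1}^m\|k_s\|^{-2}k_s$. Assume $|Rh\rangle\langle Rh|\in D(L)$ and put $U=\{x\in\mathcal H: |x\rangle\langle Rh|\in\mathcal A\}$. Assume that $U$ is norm dense in $\mathcal H$ and that there is $C>0$ with $$\|L(|x\rangle\langle Rh|)h\|\le C\|x\|\qquad\text{for all }x\in U.$$ Then $\mathcal A$ is a unital $^*$-subalgebra of $\mathcal B(\mathcal H)$, and there exist a bounded operator $G\in\mathcal B(\mathcal H)$, a Hilbert space $\mathcal K$, a bounded operator $V:\mathcal H\to\mathcal K$ and a unital norm-continuous $^*$-homomorphism $\pi:\mathcal A\to\mathcal B(\mathcal K)$ such that $$L(A)=V^*\pi(A)V+GA+AG^*\qquad\text{for all }A\in\mathcal A.$$ Moreover, the map $\mathcal A\to\mathcal B(\mathcal H)$, $A\mapsto GA+AG^*$, is continuous for the $\sigma$-weak topologies, and the map $\varphi:\mathcal A\to\mathcal B(\mathcal H)$, $\varphi(A)=V^*\pi(A)V$, is $\sigma$-weakly closable: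 if a net $(A_\lambda)$ in $\mathcal A$ satisfies $A_\lambda\to0$ and $\varphi(A_\lambda)\to B\in\mathcal B(\mathcal H)$ $\sigma$-weakly, then $B=0$. -/

import Mathlib

open scoped ComplexInnerProductSpace CStarAlgebra Topology NNReal InnerProduct
open Filter ContinuousLinearMap

universe u

section SigmaWeak

/-- The `σ`-weak (ultraweak) topology on `B(H)`: the coarsest topology for which all functionals
`A ↦ ∑ₙ ⟨xₙ, A yₙ⟩` with `∑ₙ ‖xₙ‖² < ∞` and `∑ₙ ‖yₙ‖² < ∞` are continuous. These are precisely the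
functionals `A ↦ tr (R A)` with `R` of trace class, i.e. the predual of `B(H)`.
The inner product is linear in the second variable. -/
@[reducible]
noncomputable def sigmaWeakTopology (H : Type u) [NormedAddCommGroup H] [InnerProductSpace ℂ H] :
    TopologicalSpace (H →L[ℂ] H) :=
  ⨅ (x : ℕ → H) (y : ℕ → H) (_ : Summable fun n => ‖x n‖ ^ 2) (_ : Summable fun n => ‖y n‖ ^ 2),
    TopologicalSpace.induced (fun A : H →L[ℂ] H => ∑' n, ⟪x n, A (y n)⟫) inferInstance

variable {H : Type u} [NormedAddCommGroup H] [InnerProductSpace ℂ H]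

/-- Convergence of a family of operators, along a filter, in the `σ`-weak topology. -/
def SigmaWeakTendsto {ι : Type*} (f : ι → (H →L[ℂ] H)) (l : Filter ι) (B : H →L[ℂ] H) : Prop :=
  Tendsto f l (@nhds _ (sigmaWeakTopology H) B)

theorem sigmaWeakTendsto_iff {ι : Type*} {f : ι → (H →L[ℂ] H)} {l : Filter ι} {B : H →L[ℂ] H} :
    SigmaWeakTendsto f l B ↔ ∀ x y : ℕ → H, (Summable fun n => ‖x n‖ ^ 2) →
      (Summable fun n => ‖y n‖ ^ 2) →
      Tendsto (fun i => ∑' n, ⟪x n, f i (y n)⟫) l (𝓝 (∑' n, ⟪x n, B (y n)⟫)) := by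
  simp only [SigmaWeakTendsto, nhds_iInf, tendsto_iInf, nhds_induced,
    tendsto_comap_iff]
  rfl

theorem summable_inner_apply {x y : ℕ → H} (hx : Summable fun n => ‖x n‖ ^ 2)
    (hy : Summable fun n => ‖y n‖ ^ 2) (A : H →L[ℂ] H) : Summable fun n => ⟪x n, A (y n)⟫ := by
  refine Summable.of_norm_bounded (g := fun n => ‖A‖ * (‖x n‖ ^ 2 + ‖y n‖ ^ 2))
    ((hx.add hy).mul_left _) fun n => ?_
  have h1 := norm_inner_le_norm (𝕜 := ℂ) (x n) (A (y n))
  have h2 : ‖x n‖ * ‖A (y n)‖ ≤ ‖x n‖ * (‖A‖ * ‖y n‖) := by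
    gcongr
    exact A.le_opNorm _
  have h3 : ‖A‖ * (‖x n‖ * ‖y n‖) ≤ ‖A‖ * (‖x n‖ ^ 2 + ‖y n‖ ^ 2) := by
    gcongr
    nlinarith [sq_nonneg (‖x n‖ - ‖y n‖), sq_nonneg (‖x n‖), sq_nonneg (‖y n‖)]
  linarith

theorem SigmaWeakTendsto.add {ι : Type*} {f g : ι → (H →L[ℂ] H)} {l : Filter ι}
    {B C : H →L[ℂ] H} (hf : SigmaWeakTendsto f l B) (hg : SigmaWeakTendsto g l C) :
    SigmaWeakTendsto (fun i => f i + g i) l (B + C) := by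
  rw [sigmaWeakTendsto_iff] at *
  intro x y hx hy
  have := (hf x y hx hy).add (hg x y hx hy)
  simpa only [add_apply, inner_add_right, (summable_inner_apply hx hy _).tsum_add
    (summable_inner_apply hx hy _)] using this

theorem SigmaWeakTendsto.const_smul {ι : Type*} {f : ι → (H →L[ℂ] H)} {l : Filter ι}
    {B : H →L[ℂ] H} (hf : SigmaWeakTendsto f l B) (c : ℂ) :
    SigmaWeakTendsto (fun i => c • f i) l (c • B) := by
  rw [sigmaWeakTendsto_iff] at *
  intro x y hx hy
  have := (hf x y hx hy).const_mul c
  simpa only [smul_apply, inner_smul_right, tsum_mul_left] using this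

/-- The `σ`-weak topology is Hausdorff: limits are unique. -/
theorem SigmaWeakTendsto.unique {ι : Type*} {f : ι → (H →L[ℂ] H)} {l : Filter ι} [l.NeBot]
    {B C : H →L[ℂ] H} (hB : SigmaWeakTendsto f l B) (hC : SigmaWeakTendsto f l C) : B = C := by
  rw [sigmaWeakTendsto_iff] at *
  ext v
  refine ext_inner_left ℂ fun w => ?_
  have hs : ∀ z : H, Summable fun n : ℕ => ‖(if n = 0 then z else 0 : H)‖ ^ 2 := fun z =>
    summable_of_ne_finset_zero (s := {0}) fun n hn => by
      have : n ≠ 0 := by simpa using hn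
      simp [this]
  have key := tendsto_nhds_unique (hB _ _ (hs w) (hs v)) (hC _ _ (hs w) (hs v))
  have hD : ∀ D : H →L[ℂ] H,
      (∑' n : ℕ, ⟪(if n = 0 then w else 0 : H), D (if n = 0 then v else 0)⟫) = ⟪w, D v⟫ := by
    intro D
    rw [tsum_eq_single 0 fun n hn => by simp [hn]]
    simp
  rwa [hD, hD] at key

/-- A map `φ` from a set `𝒟` of bounded operators to `B(H)` is `σ`-weakly-`σ`-weakly closable:
whenever a net in `𝒟` converges `σ`-weakly to `0` and its image under `φ` converges `σ`-weakly
to `B`, then `B = 0`. (Nets in `𝒟` are replaced by proper filters on `𝒟`.) -/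
def IsSigmaWeaklyClosable {𝒟 : Set (H →L[ℂ] H)} (φ : 𝒟 → (H →L[ℂ] H)) : Prop :=
  ∀ (l : Filter 𝒟) [l.NeBot] (B : H →L[ℂ] H),
    SigmaWeakTendsto (fun A : 𝒟 => (A : H →L[ℂ] H)) l 0 → SigmaWeakTendsto φ l B → B = 0

/-- A map from a set `𝒟` of bounded operators to `B(H)` is `σ`-weakly-`σ`-weakly continuous;
`𝒟` carries the topology induced by the `σ`-weak topology. -/
def IsSigmaWeaklyContinuous {𝒟 : Set (H →L[ℂ] H)} (φ : 𝒟 → (H →L[ℂ] H)) : Prop :=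
  @Continuous _ _ (TopologicalSpace.induced Subtype.val (sigmaWeakTopology H))
    (sigmaWeakTopology H) φ

end SigmaWeak

section QMS

/-- A quantum Markov semigroup on `B(H)`: a family `(T t)`, `t ≥ 0`, of `σ`-weakly continuous
completely positive linear maps on `B(H)` with `T 0 = id`, `T (t + s) = T t ∘ T s`, such that
`t ↦ T t A` is `σ`-weakly continuous for every `A`, and `T t 1 = 1`. -/
structure QuantumMarkovSemigroup (H : Type u) [NormedAddCommGroup H] [InnerProductSpace ℂ H]
    [CompleteSpace H] where
  /-- The map `T t`. -/
  T : ℝ≥0 → ((H →L[ℂ] H) →CP (H →L[ℂ] H))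
  sigmaWeak_continuous : ∀ t,
    @Continuous _ _ (sigmaWeakTopology H) (sigmaWeakTopology H) fun A => T t A
  map_time_zero : ∀ A, T 0 A = A
  map_time_add : ∀ t s A, T (t + s) A = T t (T s A)
  time_continuous : ∀ A, @Continuous _ _ inferInstance (sigmaWeakTopology H) fun t => T t A
  map_one : ∀ t, T t 1 = 1

namespace QuantumMarkovSemigroup

variable {H : Type u} [NormedAddCommGroup H] [InnerProductSpace ℂ H] [CompleteSpace H]
  (S : QuantumMarkovSemigroup H)

/-- `(T t A - A) / t` converges `σ`-weakly to `B` as `t ↓ 0`, i.e. `A ∈ D(L)` and `L A = B`. -/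
def HasGeneratorAt (A B : H →L[ℂ] H) : Prop :=
  SigmaWeakTendsto (fun t : ℝ≥0 => ((t : ℝ) : ℂ)⁻¹ • (S.T t A - A)) (𝓝[>] 0) B

variable {S}

theorem HasGeneratorAt.unique {A B C : H →L[ℂ] H} (hB : S.HasGeneratorAt A B)
    (hC : S.HasGeneratorAt A C) : B = C :=
  SigmaWeakTendsto.unique hB hC

theorem HasGeneratorAt.add {A A' B B' : H →L[ℂ] H} (h : S.HasGeneratorAt A B)
    (h' : S.HasGeneratorAt A' B') : S.HasGeneratorAt (A + A') (B + B') := by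
  have := SigmaWeakTendsto.add h h'
  simpa only [HasGeneratorAt, map_add, add_sub_add_comm, smul_add] using this

theorem HasGeneratorAt.smul {A B : H →L[ℂ] H} (h : S.HasGeneratorAt A B) (c : ℂ) :
    S.HasGeneratorAt (c • A) (c • B) := by
  have := SigmaWeakTendsto.const_smul h c
  simpa only [HasGeneratorAt, map_smul, ← smul_sub, smul_comm c] using this

theorem hasGeneratorAt_zero : S.HasGeneratorAt 0 0 := by
  simp only [HasGeneratorAt, map_zero, sub_zero, smul_zero]
  exact @tendsto_const_nhds _ (sigmaWeakTopology H) _ _ _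

variable (S)

/-- The generator `L` of the semigroup, as an unbounded operator on `B(H)`: its domain `D(L)`
consists of those `A` for which `(T t A - A) / t` converges `σ`-weakly as `t ↓ 0`, and `L A` is
the limit. -/
noncomputable def generator : (H →L[ℂ] H) →ₗ.[ℂ] (H →L[ℂ] H) where
  domain :=
    { carrier := {A | ∃ B, S.HasGeneratorAt A B}
      add_mem' := fun ⟨_, h⟩ ⟨_, h'⟩ => ⟨_, h.add h'⟩
      zero_mem' := ⟨0, hasGeneratorAt_zero⟩
      smul_mem' := fun c _ ⟨_, h⟩ => ⟨_, h.smul c⟩ }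
  toFun :=
    { toFun := fun A => A.2.choose
      map_add' := fun A A' =>
        (A + A').2.choose_spec.unique (A.2.choose_spec.add A'.2.choose_spec)
      map_smul' := fun c A => (c • A).2.choose_spec.unique (A.2.choose_spec.smul c) }

theorem generator_spec (A : S.generator.domain) : S.HasGeneratorAt A (S.generator A) :=
  A.2.choose_spec

/-- The domain algebra `𝒜 = {A ∈ D(L) : A* A ∈ D(L), A A* ∈ D(L)}` of the generator `L`. -/
def domainAlgebra : Set (H →L[ℂ] H) :=
  {A | A ∈ S.generator.domain ∧ adjoint A ∘L A ∈ S.generator.domain ∧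
    A ∘L adjoint A ∈ S.generator.domain}

/-- Every `*`-subalgebra contained in `D(L)` is contained in the domain algebra. -/
theorem subset_domainAlgebra (B : NonUnitalStarSubalgebra ℂ (H →L[ℂ] H))
    (hB : (B : Set (H →L[ℂ] H)) ⊆ S.generator.domain) :
    (B : Set (H →L[ℂ] H)) ⊆ S.domainAlgebra := fun _ hA =>
  ⟨hB hA, hB (mul_mem (star_mem hA) hA), hB (mul_mem hA (star_mem hA))⟩

/-- The set `U = {x ∈ H : |x⟩⟨k| ∈ 𝒜}`, where `|x⟩⟨k| v = ⟨k, v⟩ x`. -/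
def domainVectors (k : H) : Set H :=
  {x | InnerProductSpace.rankOne ℂ x k ∈ S.domainAlgebra}

theorem rankOne_mem_domain {k x : H} (hx : x ∈ S.domainVectors k) :
    InnerProductSpace.rankOne ℂ x k ∈ S.generator.domain :=
  hx.1

end QuantumMarkovSemigroup

/-- `h` is an associate vector of the positive finite rank operator `R`: for some spectral
decomposition `R = ∑ₛ t'ₛ |k'ₛ⟩⟨k'ₛ|` with `k'ₛ` orthonormal and `t'ₛ > 0`, one has
`h = ∑ₛ ‖kₛ‖⁻² kₛ`, where `kₛ = √t k'ₛ` and `t = ∑ₛ t'ₛ`. -/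
def IsAssociateVector {H : Type u} [NormedAddCommGroup H] [InnerProductSpace ℂ H]
    (R : H →L[ℂ] H) (h : H) : Prop :=
  ∃ (m : ℕ) (k' k : Fin m → H) (t' : Fin m → ℝ),
    Orthonormal ℂ k' ∧ (∀ s, 0 < t' s) ∧
    R = ∑ s, (t' s : ℂ) • InnerProductSpace.rankOne ℂ (k' s) (k' s) ∧
    (∀ s, k s = (Real.sqrt (∑ j, t' j) : ℂ) • k' s) ∧
    h = ∑ s, ((‖k s‖ ^ 2 : ℝ) : ℂ)⁻¹ • k s

end QMS

/-! Write `k = R h`. The spectral form of `h` gives ⟨k, h⟩ = 1, and this normalization is all that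
is used of `R` and `h`. The form of L then comes from a Lindblad-type argument. The generator is
conditionally completely positive: ∑ ⟨L(aⱼ* aᵢ) xᵢ, xⱼ⟩ ≥ 0 whenever ∑ aᵢ xᵢ = 0, because this sum
is the derivative at 0 of the positive definite kernels of T_t. For xᵢ in U the vector u = ∑ aᵢ xᵢ
is again in U, and adjoining the pair (|u⟩⟨k|, -h) makes the total vanish, since |u⟩⟨k| h = u.
Expanding the enlarged sum turns it into the kernel of L(A) - GA - AG*, where G = G₀ - β/2, G₀ is
the bounded extension of x ↦ L(|x⟩⟨k|)h and β = ⟨L(|k⟩⟨k|)h, h⟩. Density of U gives positivity for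
all xᵢ, and a Stinespring construction yields V and π. The bound ‖π(c)‖ ≤ ‖c‖ comes from the same
argument applied to the inequality between the kernels of `c * aᵢ` and `aᵢ`, which holds for each
T_t.

That 𝒜 is an algebra rests on two facts. D(L) is the Favard class {A : ‖T_t A - A‖ = O(t)}: a limit
B of the difference quotients along an ultrafilter satisfies T_s A - A = ∫₀ˢ T_r B dr. For this the
functionals A ↦ ∫₀ˢ ⟨x, T_r A y⟩ dr must be σ-weakly continuous (`isNormal_timeIntegral`). Secondly,
the defect ‖T(A*A) - T(A)*T(A)‖^(1/2) is a seminorm with a Leibniz inequality (`exists_defect_map`),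
and for A in D(L) its square is O(t) exactly when A*A is in D(L).

The same integral formula makes L σ-weakly closable. Subtracting the σ-weakly continuous map A ↦ GA
+ AG* keeps this property. -/

section SigmaWeakFunctionals

/-! ### Normal functionals and σ-weak limits -/

variable {H : Type u} [NormedAddCommGroup H] [InnerProductSpace ℂ H]

theorem summable_norm_inner_apply {ι : Type*} {x y : ι → H} (hx : Summable fun i => ‖x i‖ ^ 2)
    (hy : Summable fun i => ‖y i‖ ^ 2) (A : H →L[ℂ] H) :
    Summable fun i => ‖⟪x i, A (y i)⟫‖ := by
  refine Summable.of_nonneg_of_le (fun _ => norm_nonneg _) (fun i => ?_)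
    ((hx.add hy).mul_left ‖A‖)
  calc ‖⟪x i, A (y i)⟫‖ ≤ ‖x i‖ * (‖A‖ * ‖y i‖) :=
        (norm_inner_le_norm _ _).trans (by gcongr; exact A.le_opNorm _)
    _ = ‖A‖ * (‖x i‖ * ‖y i‖) := by ring
    _ ≤ ‖A‖ * (‖x i‖ ^ 2 + ‖y i‖ ^ 2) := by
        gcongr
        nlinarith [sq_nonneg (‖x i‖ - ‖y i‖), sq_nonneg (‖x i‖), sq_nonneg (‖y i‖)]

/-- The functional `A ↦ ∑ᵢ ⟨xᵢ, A yᵢ⟩` for square summable families `x` and `y`. -/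
noncomputable def vectorFunctional {ι : Type*} (x y : ι → H) (hx : Summable fun i => ‖x i‖ ^ 2)
    (hy : Summable fun i => ‖y i‖ ^ 2) : (H →L[ℂ] H) →ₗ[ℂ] ℂ where
  toFun A := ∑' i, ⟪x i, A (y i)⟫
  map_add' A B := by
    simp only [add_apply, inner_add_right]
    exact (summable_norm_inner_apply hx hy A).of_norm.tsum_add
      (summable_norm_inner_apply hx hy B).of_norm
  map_smul' c A := by
    simp only [smul_apply, inner_smul_right, tsum_mul_left, RingHom.id_apply, smul_eq_mul]

theorem vectorFunctional_apply {ι : Type*} {x y : ι → H} (hx : Summable fun i => ‖x i‖ ^ 2)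
    (hy : Summable fun i => ‖y i‖ ^ 2) (A : H →L[ℂ] H) :
    vectorFunctional x y hx hy A = ∑' i, ⟪x i, A (y i)⟫ := rfl

/-- A complex function on `B(H)` is normal if it is continuous for the `σ`-weak topology. -/
def IsNormal (f : (H →L[ℂ] H) → ℂ) : Prop :=
  @Continuous _ _ (sigmaWeakTopology H) inferInstance f

theorem IsNormal.tendsto {f : (H →L[ℂ] H) → ℂ} (hf : IsNormal f) {ι : Type*}
    {g : ι → (H →L[ℂ] H)} {l : Filter ι} {B : H →L[ℂ] H} (hg : SigmaWeakTendsto g l B) :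
    Tendsto (fun i => f (g i)) l (𝓝 (f B)) :=
  (@Continuous.tendsto _ _ (sigmaWeakTopology H) _ _ hf B).comp hg

theorem IsNormal.add {f g : (H →L[ℂ] H) → ℂ} (hf : IsNormal f) (hg : IsNormal g) :
    IsNormal fun A => f A + g A :=
  @Continuous.add _ _ _ _ _ (sigmaWeakTopology H) _ _ hf hg

theorem IsNormal.const_mul {f : (H →L[ℂ] H) → ℂ} (hf : IsNormal f) (c : ℂ) :
    IsNormal fun A => c * f A :=
  @Continuous.mul _ _ _ _ _ (sigmaWeakTopology H) _ _
    (@continuous_const _ _ (sigmaWeakTopology H) _ c) hf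

theorem isNormal_tsum_nat {x y : ℕ → H} (hx : Summable fun n => ‖x n‖ ^ 2)
    (hy : Summable fun n => ‖y n‖ ^ 2) : IsNormal fun A : H →L[ℂ] H => ∑' n, ⟪x n, A (y n)⟫ :=
  continuous_iInf_dom (i := x) <| continuous_iInf_dom (i := y) <| continuous_iInf_dom (i := hx) <|
    continuous_iInf_dom (i := hy) continuous_induced_dom

/-- A square summable family has countable support, so the sum over any index type is a sum over ℕ
after embedding the support and extending by zero. -/
theorem isNormal_vectorFunctional {ι : Type*} {x y : ι → H} (hx : Summable fun i => ‖x i‖ ^ 2)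
    (hy : Summable fun i => ‖y i‖ ^ 2) : IsNormal (vectorFunctional x y hx hy) := by
  set s := Function.support fun i => ‖x i‖ ^ 2
  have hs : s.Countable := hx.countable_support
  have : Countable s := hs
  obtain ⟨e, he⟩ := exists_injective_nat s
  have hext : ∀ {z : ι → H}, (Summable fun i => ‖z i‖ ^ 2) →
      Summable fun n => ‖Function.extend e (fun i : s => z i) 0 n‖ ^ 2 := by
    intro z hz
    have h0 : (fun n => ‖Function.extend e (fun i : s => z i) 0 n‖ ^ 2)
        = Function.extend e (fun i : s => ‖z i‖ ^ 2) 0 := by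
      funext n
      by_cases hn : ∃ i, e i = n
      · obtain ⟨i, rfl⟩ := hn
        simp [he.extend_apply]
      · simp [Function.extend_apply' _ _ _ hn]
    rw [h0, summable_extend_zero he]
    exact hz.comp_injective Subtype.val_injective
  have key := isNormal_tsum_nat (hext hx) (hext hy)
  convert key using 2 with A
  have h1 : (fun n => ⟪Function.extend e (fun i : s => x i) 0 n,
      A (Function.extend e (fun i : s => y i) 0 n)⟫)
      = Function.extend e (fun i : s => ⟪x i, A (y i)⟫) 0 := by
    funext n
    by_cases hn : ∃ i, e i = n
    · obtain ⟨i, rfl⟩ := hn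
      simp [he.extend_apply]
    · simp [Function.extend_apply' _ _ _ hn]
  rw [h1, tsum_extend_zero he, vectorFunctional_apply,
    tsum_subtype_eq_of_support_subset (f := fun i => ⟪x i, A (y i)⟫)]
  intro i hi h0
  refine hi ?_
  have : x i = 0 := by simpa [s] using h0
  simp [this]

theorem isNormal_inner (x y : H) : IsNormal fun A : H →L[ℂ] H => ⟪x, A y⟫ := by
  have h := isNormal_vectorFunctional (ι := Unit) (x := fun _ => x) (y := fun _ => y)
    Summable.of_finite Summable.of_finite
  simpa [IsNormal, vectorFunctional] using h

theorem SigmaWeakTendsto.inner {ι : Type*} {f : ι → (H →L[ℂ] H)} {l : Filter ι}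
    {B : H →L[ℂ] H} (hf : SigmaWeakTendsto f l B) (x y : H) :
    Tendsto (fun i => ⟪x, f i y⟫) l (𝓝 ⟪x, B y⟫) :=
  (isNormal_inner x y).tendsto hf

theorem tendsto_vectorFunctional_of_bounded {κ : Type*} {x y : κ → H}
    (hx : Summable fun i => ‖x i‖ ^ 2) (hy : Summable fun i => ‖y i‖ ^ 2)
    {ι : Type*} {f : ι → (H →L[ℂ] H)} {l : Filter ι}
    {B : H →L[ℂ] H} {M : ℝ} (hM : ∀ᶠ i in l, ‖f i‖ ≤ M)
    (hf : ∀ x y, Tendsto (fun i => ⟪x, f i y⟫) l (𝓝 ⟪x, B y⟫)) :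
    Tendsto (fun i => vectorFunctional x y hx hy (f i)) l
      (𝓝 (vectorFunctional x y hx hy B)) := by
  refine tendsto_tsum_of_dominated_convergence
    (bound := fun n => M * (‖x n‖ ^ 2 + ‖y n‖ ^ 2)) ((hx.add hy).mul_left _)
    (fun n => hf _ _) ?_
  filter_upwards [hM] with i hi n
  calc ‖⟪x n, f i (y n)⟫‖ ≤ ‖x n‖ * (‖f i‖ * ‖y n‖) :=
        (norm_inner_le_norm _ _).trans (by gcongr; exact (f i).le_opNorm _)
    _ = ‖f i‖ * (‖x n‖ * ‖y n‖) := by ring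
    _ ≤ M * (‖x n‖ ^ 2 + ‖y n‖ ^ 2) := by
        have := (norm_nonneg (f i)).trans hi
        gcongr
        nlinarith [sq_nonneg (‖x n‖ - ‖y n‖), sq_nonneg (‖x n‖), sq_nonneg (‖y n‖)]

/-- A bounded family converging in the weak operator topology converges `σ`-weakly. -/
theorem sigmaWeakTendsto_of_bounded {ι : Type*} {f : ι → (H →L[ℂ] H)} {l : Filter ι}
    {B : H →L[ℂ] H} {M : ℝ} (hM : ∀ᶠ i in l, ‖f i‖ ≤ M)
    (hf : ∀ x y, Tendsto (fun i => ⟪x, f i y⟫) l (𝓝 ⟪x, B y⟫)) : SigmaWeakTendsto f l B :=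
  sigmaWeakTendsto_iff.2 fun _ _ hx hy => tendsto_vectorFunctional_of_bounded hx hy hM hf

theorem inner_apply_polarization (A : H →L[ℂ] H) (x y : H) :
    ⟪x, A y⟫ = (1 / 4 : ℂ) * ⟪x + y, A (x + y)⟫ + (-1 / 4 : ℂ) * ⟪x - y, A (x - y)⟫
      + (Complex.I / 4) * ⟪x - Complex.I • y, A (x - Complex.I • y)⟫
      + (-Complex.I / 4) * ⟪x + Complex.I • y, A (x + Complex.I • y)⟫ := by
  simp only [map_add, map_sub, map_smul, inner_add_left, inner_add_right, inner_sub_left,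
    inner_sub_right, inner_smul_left, inner_smul_right, Complex.conj_I]
  linear_combination (⟪x, A y⟫ / 2 - ⟪y, A x⟫ / 2) * Complex.I_sq

/-- The weak operator limit of a bounded family along an ultrafilter. -/
theorem exists_sigmaWeakTendsto_of_ultrafilter [CompleteSpace H] {ι : Type*} {f : ι → (H →L[ℂ] H)}
    (l : Ultrafilter ι) {M : ℝ} (hM : ∀ᶠ i in l, ‖f i‖ ≤ M) :
    ∃ B : H →L[ℂ] H, SigmaWeakTendsto f l B := by
  have hb : ∀ x y, ∀ᶠ i in l, ‖⟪f i x, y⟫‖ ≤ M * ‖x‖ * ‖y‖ := by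
    intro x y
    filter_upwards [hM] with i hi
    refine (norm_inner_le_norm _ _).trans ?_
    gcongr
    exact (f i).le_of_opNorm_le hi x
  have hlim : ∀ x y, ∃ z, Tendsto (fun i => ⟪f i x, y⟫) l (𝓝 z) := by
    intro x y
    have hc := (isCompact_closedBall (0 : ℂ) (M * ‖x‖ * ‖y‖)).ultrafilter_le_nhds
      (l.map fun i => ⟪f i x, y⟫) (by
        rw [le_principal_iff, Ultrafilter.mem_coe, Ultrafilter.mem_map]
        refine Filter.mem_of_superset (hb x y) fun i hi => ?_
        simpa using hi)
    obtain ⟨z, -, hz⟩ := hc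
    exact ⟨z, hz⟩
  choose β hβ using hlim
  -- The limits of the matrix elements form a bounded sesquilinear form; its representing operator
  -- is the limit.
  let φ : H →ₗ⋆[ℂ] H →ₗ[ℂ] ℂ := LinearMap.mk₂'ₛₗ _ _ β
    (fun x x' y => tendsto_nhds_unique (hβ _ _) <| by
      simpa only [map_add, inner_add_left] using (hβ x y).add (hβ x' y))
    (fun c x y => tendsto_nhds_unique (hβ _ _) <| by
      simpa only [map_smul, inner_smul_left, smul_eq_mul] using (hβ x y).const_mul (starRingEnd ℂ c))
    (fun x y y' => tendsto_nhds_unique (hβ _ _) <| by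
      simpa only [inner_add_right] using (hβ x y).add (hβ x y'))
    (fun c x y => tendsto_nhds_unique (hβ _ _) <| by
      simpa only [inner_smul_right, smul_eq_mul, RingHom.id_apply] using (hβ x y).const_mul c)
  let Φ : H →L⋆[ℂ] H →L[ℂ] ℂ := φ.mkContinuous₂ M fun x y =>
    le_of_tendsto (hβ x y).norm (hb x y)
  refine ⟨InnerProductSpace.continuousLinearMapOfBilin Φ, sigmaWeakTendsto_of_bounded hM ?_⟩
  intro x y
  have h1 := (hβ y x).star
  rw [show β y x = Φ y x from rfl, ← InnerProductSpace.continuousLinearMapOfBilin_apply] at h1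
  simpa only [RCLike.star_def, inner_conj_symm] using h1

end SigmaWeakFunctionals

/-! ### Positive functionals: complete additivity implies normality -/

section PositiveFunctionals

open scoped ComplexOrder

theorem PositiveLinearMap.norm_apply_star_mul_le {A : Type*} [CStarAlgebra A] [PartialOrder A]
    [StarOrderedRing A] (f : A →ₚ[ℂ] ℂ) (a b : A) :
    ‖f (star a * b)‖ ≤ √(f (star a * a)).re * √(f (star b * b)).re := by
  simpa only [PositiveLinearMap.preGNS_norm_def, PositiveLinearMap.preGNS_inner_def,
    PositiveLinearMap.ofPreGNS_toPreGNS] using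
    norm_inner_le_norm (𝕜 := ℂ) (f.toPreGNS a) (f.toPreGNS b)

variable {H : Type u} [NormedAddCommGroup H] [InnerProductSpace ℂ H]

/-- The orthogonal projection onto the span of finitely many vectors of a Hilbert basis. -/
noncomputable def HilbertBasis.finProj {ι : Type*} (b : HilbertBasis ι ℂ H) (F : Finset ι) :
    H →L[ℂ] H :=
  ∑ i ∈ F, InnerProductSpace.rankOne ℂ (b i) (b i)

namespace HilbertBasis

variable {ι : Type*} (b : HilbertBasis ι ℂ H)

theorem finProj_apply (F : Finset ι) (x : H) : b.finProj F x = ∑ i ∈ F, ⟪b i, x⟫ • b i := by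
  simp [finProj, sum_apply]

theorem tendsto_finProj_apply (x : H) : Tendsto (fun F => b.finProj F x) atTop (𝓝 x) := by
  have h := b.hasSum_repr x
  simp only [HasSum, SummationFilter.unconditional_filter, b.repr_apply_apply] at h
  simpa only [finProj_apply] using h

theorem finProj_mul_finProj (F : Finset ι) : b.finProj F * b.finProj F = b.finProj F := by
  classical
  rw [finProj, Finset.sum_mul_sum]
  refine Finset.sum_congr rfl fun i hi => ?_
  rw [Finset.sum_eq_single i]
  · rw [mul_def, InnerProductSpace.rankOne_comp_rankOne, inner_self_eq_norm_sq_to_K,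
      b.orthonormal.1 i]
    simp
  · intro j _ hj
    rw [mul_def, InnerProductSpace.rankOne_comp_rankOne, b.orthonormal.2 hj.symm, zero_smul]
  · exact fun h => absurd hi h

theorem finProj_mul_mul_finProj (A : H →L[ℂ] H) (F : Finset ι) :
    b.finProj F * A * b.finProj F
      = ∑ i ∈ F, ∑ j ∈ F, ⟪b i, A (b j)⟫ • InnerProductSpace.rankOne ℂ (b i) (b j) := by
  simp only [finProj, Finset.sum_mul, Finset.mul_sum]
  rw [Finset.sum_comm]
  refine Finset.sum_congr rfl fun i _ => Finset.sum_congr rfl fun j _ => ?_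
  rw [mul_assoc, mul_def, mul_def, InnerProductSpace.comp_rankOne,
    InnerProductSpace.rankOne_comp_rankOne]

variable [CompleteSpace H]

theorem star_finProj (F : Finset ι) : star (b.finProj F) = b.finProj F := by
  simp [finProj, star_eq_adjoint]

theorem isStarProjection_finProj (F : Finset ι) : IsStarProjection (b.finProj F) :=
  ⟨b.finProj_mul_finProj F, b.star_finProj F⟩

theorem norm_finProj_le (F : Finset ι) : ‖b.finProj F‖ ≤ 1 :=
  (b.isStarProjection_finProj F).norm_le

theorem finProj_mono : Monotone b.finProj := by
  intro F G hFG
  refine Finset.sum_le_sum_of_subset_of_nonneg hFG fun i _ _ => ?_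
  rw [nonneg_iff_isPositive]
  exact InnerProductSpace.isPositive_rankOne_self _

theorem one_sub_finProj_nonneg (F : Finset ι) : 0 ≤ 1 - b.finProj F :=
  (b.isStarProjection_finProj F).one_sub.nonneg

theorem tendsto_inner_finProj_mul_mul_finProj (A : H →L[ℂ] H) (x y : H) :
    Tendsto (fun F => ⟪x, (b.finProj F * A * b.finProj F) y⟫) atTop (𝓝 ⟪x, A y⟫) := by
  have h : ∀ F, ⟪x, (b.finProj F * A * b.finProj F) y⟫ = ⟪b.finProj F x, A (b.finProj F y)⟫ := by
    intro F
    conv_rhs => rw [← b.star_finProj F, star_eq_adjoint, adjoint_inner_left]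
    rw [← star_eq_adjoint, b.star_finProj F]
    rfl
  simp only [h]
  exact (b.tendsto_finProj_apply x).inner ((A.continuous.tendsto _).comp (b.tendsto_finProj_apply y))

theorem norm_finProj_mul_mul_finProj_le (A : H →L[ℂ] H) (F : Finset ι) :
    ‖b.finProj F * A * b.finProj F‖ ≤ ‖A‖ := by
  calc ‖b.finProj F * A * b.finProj F‖ ≤ ‖b.finProj F‖ * ‖A‖ * ‖b.finProj F‖ :=
        (norm_mul_le _ _).trans (by gcongr; exact norm_mul_le _ _)
    _ ≤ 1 * ‖A‖ * 1 := by gcongr <;> exact b.norm_finProj_le F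
    _ = ‖A‖ := by ring

theorem sigmaWeakTendsto_one_sub_finProj :
    SigmaWeakTendsto (fun F => 1 - b.finProj F) atTop 0 := by
  refine sigmaWeakTendsto_of_bounded (M := 1)
    (Eventually.of_forall fun F => (b.isStarProjection_finProj F).one_sub.norm_le) fun x y => ?_
  have := tendsto_const_nhds (x := x) |>.inner (𝕜 := ℂ)
    (tendsto_const_nhds (x := y) |>.sub (b.tendsto_finProj_apply y))
  simpa [inner_sub_right] using this

/-- A positive functional on `B(H)` is approximated by its compressions as soon as it is
completely additive along the projections of a Hilbert basis. -/
theorem tendsto_apply_finProj_mul_mul_finProj (f : (H →L[ℂ] H) →ₚ[ℂ] ℂ)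
    (hf : Tendsto (fun F => f (1 - b.finProj F)) atTop (𝓝 0)) (A : H →L[ℂ] H) :
    Tendsto (fun F => f (b.finProj F * A * b.finProj F)) atTop (𝓝 (f A)) := by
  obtain ⟨C, hC⟩ := f.exists_norm_apply_le
  have hsq : ∀ X : H →L[ℂ] H, √(f (star X * X)).re ≤ √(C * (‖X‖ * ‖X‖)) := by
    intro X
    refine Real.sqrt_le_sqrt ((Complex.re_le_norm _).trans ((hC _).trans ?_))
    rw [CStarRing.norm_star_mul_self]
  have hstar : ∀ F, star (1 - b.finProj F) = 1 - b.finProj F := fun F => by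
    rw [star_sub, star_one, b.star_finProj]
  have hQ : ∀ F, star (1 - b.finProj F) * (1 - b.finProj F) = 1 - b.finProj F := fun F => by
    rw [hstar]
    exact (b.isStarProjection_finProj F).one_sub.1
  have hAP : ∀ F, ‖star A * b.finProj F‖ ≤ ‖A‖ := fun F =>
    (norm_mul_le _ _).trans <| by
      rw [norm_star]
      exact mul_le_of_le_one_right (norm_nonneg _) (b.norm_finProj_le F)
  have hdiff : ∀ F, ‖f (b.finProj F * A * b.finProj F) - f A‖
      ≤ √(f (1 - b.finProj F)).re * √(C * (‖A‖ * ‖A‖))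
        + √(C * (‖A‖ * ‖A‖)) * √(f (1 - b.finProj F)).re := by
    intro F
    -- With P the projection and Q = 1 - P, A - PAP = QA + PAQ. By Cauchy–Schwarz each term costs a
    -- factor f(Q)^(1/2), which tends to 0.
    have h1 : b.finProj F * A * b.finProj F - A = -(star (1 - b.finProj F) * A
        + star (star A * b.finProj F) * (1 - b.finProj F)) := by
      rw [hstar, star_mul, star_star, b.star_finProj]
      noncomm_ring
    rw [← map_sub, h1, map_neg, norm_neg, map_add]
    refine (norm_add_le _ _).trans (add_le_add ?_ ?_)
    · refine (f.norm_apply_star_mul_le _ _).trans ?_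
      rw [hQ]
      exact mul_le_mul_of_nonneg_left (hsq A) (Real.sqrt_nonneg _)
    · refine (f.norm_apply_star_mul_le _ _).trans ?_
      rw [hQ]
      refine mul_le_mul_of_nonneg_right ((hsq _).trans (Real.sqrt_le_sqrt ?_)) (Real.sqrt_nonneg _)
      gcongr <;> exact hAP F
  rw [tendsto_iff_norm_sub_tendsto_zero]
  have h0 : Tendsto (fun F => √(f (1 - b.finProj F)).re) atTop (𝓝 0) := by
    have := (Real.continuous_sqrt.comp Complex.continuous_re).tendsto 0 |>.comp hf
    simpa only [Function.comp_def, Complex.zero_re, Real.sqrt_zero] using this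
  refine squeeze_zero (fun _ => norm_nonneg _) hdiff ?_
  simpa using (h0.mul_const _).add (h0.const_mul _)

end HilbertBasis

variable [CompleteSpace H]

/-- A positive functional on `B(H)` which is completely additive along the projections of a
Hilbert basis is normal. -/
theorem PositiveLinearMap.isNormal_of_tendsto {ι : Type*} (b : HilbertBasis ι ℂ H)
    (f : (H →L[ℂ] H) →ₚ[ℂ] ℂ)
    (hf : Tendsto (fun F => f (1 - b.finProj F)) atTop (𝓝 0)) : IsNormal f := by
  obtain ⟨C, hC⟩ := f.exists_norm_apply_le
  let f' : (H →L[ℂ] H) →L[ℂ] ℂ := f.toLinearMap.mkContinuous C hC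
  let Φ : H →L⋆[ℂ] H →L[ℂ] ℂ :=
    (ContinuousLinearMap.compL ℂ H (H →L[ℂ] H) ℂ f').comp
      (InnerProductSpace.rankOne ℂ (E := H) (F := H)).flip
  -- The density operator of f. Its square root will be Hilbert–Schmidt because ∑ ‖ρ^(1/2) bᵢ‖² ≤
  -- f(1), which writes f as a vector functional.
  let ρ := InnerProductSpace.continuousLinearMapOfBilin Φ
  have hρ : ∀ v w, ⟪ρ v, w⟫ = f (InnerProductSpace.rankOne ℂ w v) := fun v w =>
    InnerProductSpace.continuousLinearMapOfBilin_apply Φ v w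
  have hr : ∀ v : H, 0 ≤ InnerProductSpace.rankOne ℂ v v := fun v => by
    rw [nonneg_iff_isPositive]
    exact InnerProductSpace.isPositive_rankOne_self _
  have hρ0 : 0 ≤ ρ := by
    rw [nonneg_iff_isPositive, isPositive_iff_complex]
    intro v
    have h := map_nonneg f (hr v)
    rw [← hρ, Complex.nonneg_iff] at h
    exact ⟨Complex.ext (by simp) (by simpa using h.2), h.1⟩
  set S := CFC.sqrt ρ
  have hSS : S * S = ρ := CFC.sqrt_mul_sqrt_self ρ hρ0
  have hSa : adjoint S = S := by
    have : IsSelfAdjoint S := IsSelfAdjoint.of_nonneg (CFC.sqrt_nonneg ρ)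
    exact this
  have hS : ∀ v w, ⟪S v, S w⟫ = ⟪ρ v, w⟫ := by
    intro v w
    rw [← hSS, ← adjoint_inner_left, hSa]
    rfl
  have hsum : Summable fun i => ‖S (b i)‖ ^ 2 := by
    refine summable_of_sum_le (c := (f 1).re) (fun _ => by positivity) fun F => ?_
    have h1 : ((∑ i ∈ F, ‖S (b i)‖ ^ 2 : ℝ) : ℂ) = f (b.finProj F) := by
      rw [HilbertBasis.finProj, map_sum]
      push_cast
      refine Finset.sum_congr rfl fun i _ => ?_
      rw [← hρ, ← hS, inner_self_eq_norm_sq_to_K]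
      rfl
    have h2 : f (b.finProj F) ≤ f 1 :=
      OrderHomClass.mono f (sub_nonneg.1 (b.one_sub_finProj_nonneg F))
    rw [← h1] at h2
    exact (Complex.le_def.1 h2).1
  let η := vectorFunctional (fun i => S (b i)) (fun i => S (b i)) hsum hsum
  have hrank : ∀ v w, η (InnerProductSpace.rankOne ℂ w v) = f (InnerProductSpace.rankOne ℂ w v) := by
    intro v w
    rw [← hρ, ← hS, ← b.tsum_inner_mul_inner (S v) (S w), vectorFunctional_apply]
    refine tsum_congr fun i => ?_
    rw [InnerProductSpace.rankOne_apply, inner_smul_right,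
      ← adjoint_inner_left, hSa, ← adjoint_inner_right S (b i), hSa]
  -- Both functionals agree on rank one operators, hence on the finite compressions of A, and both
  -- are recovered from these in the limit.
  have hη : (f : (H →L[ℂ] H) → ℂ) = η := by
    funext A
    refine tendsto_nhds_unique (b.tendsto_apply_finProj_mul_mul_finProj f hf A) ?_
    have h1 := tendsto_vectorFunctional_of_bounded hsum hsum
      (Eventually.of_forall (b.norm_finProj_mul_mul_finProj_le A))
      (b.tendsto_inner_finProj_mul_mul_finProj A)
    refine h1.congr fun F => ?_
    change η _ = f _
    simp only [b.finProj_mul_mul_finProj, map_sum, map_smul, hrank]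
  rw [hη]
  exact isNormal_vectorFunctional hsum hsum

end PositiveFunctionals

/-! ### Stinespring dilation over a unital *-algebra -/

section Dilation

variable {H : Type u} [NormedAddCommGroup H] [InnerProductSpace ℂ H] [CompleteSpace H]

theorem norm_sq_sum_eq_re_sum_inner {α K : Type*} [NormedAddCommGroup K] [InnerProductSpace ℂ K]
    (s : Finset α) (f : α → K) :
    ‖∑ a ∈ s, f a‖ ^ 2 = (∑ a ∈ s, ∑ b ∈ s, ⟪f a, f b⟫).re := by
  rw [← inner_self_eq_norm_sq (𝕜 := ℂ), sum_inner]
  simp only [inner_sum]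
  rfl

/-- **Stinespring dilation** of a completely positive map on a unital `*`-algebra `𝒜` for which
left multiplication by `c` is bounded by `N c`. -/
theorem exists_stinespring_dilation {𝒜 : Type u} [Ring 𝒜] [StarRing 𝒜] [Algebra ℂ 𝒜]
    [StarModule ℂ 𝒜]
    (φ : 𝒜 →ₗ[ℂ] H →L[ℂ] H) (N : 𝒜 → ℝ) (hN : ∀ a, 0 ≤ N a)
    (hstar : ∀ a, φ (star a) = star (φ a))
    (hpos : ∀ (s : Finset 𝒜) (x : 𝒜 → H),
      0 ≤ (∑ a ∈ s, ∑ b ∈ s, ⟪φ (star b * a) (x a), x b⟫).re)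
    (hbd : ∀ (c : 𝒜) (s : Finset 𝒜) (x : 𝒜 → H),
      (∑ a ∈ s, ∑ b ∈ s, ⟪φ (star (c * b) * (c * a)) (x a), x b⟫).re ≤
        N c ^ 2 * (∑ a ∈ s, ∑ b ∈ s, ⟪φ (star b * a) (x a), x b⟫).re) :
    ∃ (K : Type u) (_ : NormedAddCommGroup K) (_ : InnerProductSpace ℂ K) (_ : CompleteSpace K)
      (V : H →L[ℂ] K) (π : 𝒜 →⋆ₐ[ℂ] (K →L[ℂ] K)),
      (∀ a, ‖π a‖ ≤ N a) ∧ ∀ a, φ a = adjoint V ∘L π a ∘L V := by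
  classical
  -- The dilation space is the reproducing kernel Hilbert space of (b, a) ↦ φ(b* a); `Λ a x` below
  -- plays the role of a ⊗ x.
  let M : Matrix 𝒜 𝒜 (H →L[ℂ] H) := Matrix.of fun b a => φ (star b * a)
  have hM : M.PosSemidef := by
    have htfae := (RKHS.posSemidef_tfae (K := M)).out 0 2
    refine htfae.2 ⟨?_, fun v => hpos v.support v⟩
    ext1 b a
    simp [M, Matrix.conjTranspose_apply, ← hstar]
  have : Fact M.PosSemidef := ⟨hM⟩
  let K := RKHS.OfKernel M
  let Λ : 𝒜 → H →L[ℂ] K := fun a => RKHS.kerFun K a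
  have hΛ : ∀ a b x y, ⟪Λ a x, Λ b y⟫ = ⟪φ (star b * a) x, y⟫ := fun a b x y => by
    rw [← RKHS.kernel_inner, RKHS.OfKernel.kernel_ofKernel]
    rfl
  let L : 𝒜 → (𝒜 →₀ H) →ₗ[ℂ] K := fun c => Finsupp.lsum ℂ fun a => (Λ (c * a)).toLinearMap
  have hL : ∀ c v, L c v = ∑ a ∈ v.support, Λ (c * a) (v a) := fun c v => rfl
  have hLs : ∀ c a x, L c (Finsupp.single a x) = Λ (c * a) x := fun c a x => by
    simp [L]
  have hdense : DenseRange (L 1) := by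
    rw [DenseRange, ← LinearMap.coe_range, Submodule.dense_iff_topologicalClosure_eq_top,
      eq_top_iff, ← RKHS.kerFun_dense K]
    refine Submodule.topologicalClosure_mono (Submodule.span_le.2 ?_)
    rintro _ ⟨a, x, rfl⟩
    exact ⟨Finsupp.single a x, by rw [hLs, one_mul]⟩
  have hbound : ∀ c v, ‖L c v‖ ≤ N c * ‖L 1 v‖ := by
    intro c v
    rw [← sq_le_sq₀ (norm_nonneg _) (mul_nonneg (hN c) (norm_nonneg _)), mul_pow, hL, hL,
      norm_sq_sum_eq_re_sum_inner, norm_sq_sum_eq_re_sum_inner]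
    simpa only [hΛ, one_mul] using hbd c v.support v
  -- By `hbound`, left multiplication by c on formal sums descends along `L 1`, whose range is
  -- dense, to a bounded operator on K.
  let P : 𝒜 → K →L[ℂ] K := fun c => (L c).extendOfNorm (L 1)
  have hP : ∀ c a x, P c (Λ a x) = Λ (c * a) x := by
    intro c a x
    have h := LinearMap.extendOfNorm_eq hdense ⟨N c, hbound c⟩ (Finsupp.single a x)
    rwa [hLs, hLs, one_mul] at h
  have hext : ∀ S T : K →L[ℂ] K, (∀ a x, S (Λ a x) = T (Λ a x)) → S = T := by
    intro S T h
    refine ContinuousLinearMap.coeFn_injective (hdense.equalizer S.continuous T.continuous ?_)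
    funext v
    simp only [Function.comp_apply, hL, map_sum, h]
  -- The reproducing kernel space treats 𝒜 as a mere index set, so linearity in a has to be
  -- recovered: the difference has norm zero.
  have hadd : ∀ a b x, Λ (a + b) x = Λ a x + Λ b x := by
    intro a b x
    rw [← sub_eq_zero, ← inner_self_eq_zero (𝕜 := ℂ)]
    simp only [inner_sub_left, inner_sub_right, inner_add_left, inner_add_right, hΛ, star_add,
      add_mul, mul_add, map_add, add_apply]
    ring
  have hsmul : ∀ (r : ℂ) a x, Λ (r • a) x = r • Λ a x := by
    intro r a x
    rw [← sub_eq_zero, ← inner_self_eq_zero (𝕜 := ℂ)]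
    simp only [inner_sub_left, inner_sub_right, inner_smul_left, inner_smul_right, hΛ, star_smul,
      smul_mul_assoc, mul_smul_comm, map_smul, smul_apply, RCLike.star_def, Complex.conj_conj]
    ring
  let π : 𝒜 →⋆ₐ[ℂ] (K →L[ℂ] K) :=
    { toFun := P
      map_one' := hext _ _ fun a x => by rw [hP, one_mul]; rfl
      map_mul' := fun c d => hext _ _ fun a x => by
        change _ = P c (P d (Λ a x))
        rw [hP, hP, hP, mul_assoc]
      map_zero' := hext _ _ fun a x => by
        have h0 := hsmul 0 0 x
        rw [zero_smul, zero_smul] at h0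
        rw [hP, zero_mul, h0, zero_apply]
      map_add' := fun c d => hext _ _ fun a x => by
        rw [hP, add_apply, hP, hP, add_mul, hadd]
      commutes' := fun r => hext _ _ fun a x => by
        rw [hP, ← Algebra.smul_def, hsmul, Algebra.algebraMap_eq_smul_one, smul_apply]
        rfl
      map_star' := fun c => by
        have h1 : ∀ a x b y, ⟪P (star c) (Λ a x), Λ b y⟫ = ⟪Λ a x, P c (Λ b y)⟫ := by
          intro a x b y
          rw [hP, hP, hΛ, hΛ, star_mul, mul_assoc]
        rw [star_eq_adjoint]
        refine hext _ _ fun a x => ?_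
        refine hdense.eq_of_inner_left ℂ fun v => ?_
        rw [adjoint_inner_left]
        simp only [hL, one_mul, map_sum, inner_sum, h1] }
  refine ⟨K, inferInstance, inferInstance, inferInstance, Λ 1, π, fun a => ?_, fun a => ?_⟩
  · exact LinearMap.opNorm_extendOfNorm_le hdense (hN a) (hbound a)
  · ext x
    refine ext_inner_right ℂ fun y => ?_
    change _ = ⟪adjoint (Λ 1) (P a (Λ 1 x)), y⟫
    rw [adjoint_inner_left, hP, hΛ, star_one, one_mul, mul_one]

end Dilation

/-! ### Kernels of completely positive maps -/

theorem Finset.sum_sum_coe_sort {α M : Type*} [AddCommMonoid M] (s : Finset α) (f : α → α → M) :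
    ∑ i : s, ∑ j : s, f i j = ∑ i ∈ s, ∑ j ∈ s, f i j := by
  rw [← Finset.sum_coe_sort s]
  exact Finset.sum_congr rfl fun i _ => Finset.sum_coe_sort s (f i)

/-- Positive matrices are generated by the P*P, for which the sum is ∑ₖ ‖∑ᵢ Pₖᵢ xᵢ‖². -/
theorem CStarMatrix.re_sum_inner_nonneg {H : Type u} [NormedAddCommGroup H]
    [InnerProductSpace ℂ H] [CompleteSpace H] {ι : Type*} [Fintype ι]
    {M : CStarMatrix ι ι (H →L[ℂ] H)} (hM : 0 ≤ M) (x : ι → H) :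
    0 ≤ (∑ i, ∑ j, ⟪M j i (x i), x j⟫).re := by
  rw [StarOrderedRing.nonneg_iff] at hM
  induction hM using AddSubmonoid.closure_induction with
  | mem M hM =>
    obtain ⟨P, rfl⟩ := hM
    have h1 : ∑ i, ∑ j, ⟪(star P * P) j i (x i), x j⟫
        = ∑ k, ∑ i, ∑ j, ⟪P k i (x i), P k j (x j)⟫ := by
      rw [Finset.sum_comm (s := Finset.univ) (t := Finset.univ)
        (f := fun k i => ∑ j, ⟪P k i (x i), P k j (x j)⟫)]
      refine Finset.sum_congr rfl fun i _ => ?_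
      rw [Finset.sum_comm]
      refine Finset.sum_congr rfl fun j _ => ?_
      rw [CStarMatrix.mul_apply, sum_apply, sum_inner]
      refine Finset.sum_congr rfl fun k _ => ?_
      rw [CStarMatrix.star_apply, star_eq_adjoint, mul_def, comp_apply, adjoint_inner_left]
    rw [h1, Complex.re_sum]
    simp only [← norm_sq_sum_eq_re_sum_inner]
    positivity
  | zero => simp
  | add M M' _ _ h h' =>
    have h1 : ∀ i j, ⟪(M + M') j i (x i), x j⟫ = ⟪M j i (x i), x j⟫ + ⟪M' j i (x i), x j⟫ :=
      fun i j => inner_add_left _ _ _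
    simp only [h1, Finset.sum_add_distrib, Complex.add_re]
    exact add_nonneg h h'

namespace CompletelyPositiveMap

variable {H : Type u} [NormedAddCommGroup H] [InnerProductSpace ℂ H] [CompleteSpace H]
  (T : (H →L[ℂ] H) →CP (H →L[ℂ] H))

theorem map_star' (A : H →L[ℂ] H) : T (star A) = star (T A) :=
  map_star (PositiveLinearMap.mk (T.toLinearMap) (OrderHomClass.mono T)) A

/-- The kernel `(A, B) ↦ T (A* B)` of a completely positive map is positive definite. -/
theorem re_sum_inner_nonneg {ι : Type*} [Fintype ι] (a : ι → H →L[ℂ] H) (x : ι → H) :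
    0 ≤ (∑ i, ∑ j, ⟪T (star (a j) * a i) (x i), x j⟫).re := by
  classical
  rcases isEmpty_or_nonempty ι with h | ⟨⟨i₀⟩⟩
  · simp
  -- The matrix with the single nonzero row (aᵢ), so that N*N has entries aⱼ* aᵢ.
  let N : CStarMatrix ι ι (H →L[ℂ] H) := CStarMatrix.ofMatrix (Matrix.of fun k i =>
    if k = i₀ then a i else 0)
  have hN : ∀ j i, (star N * N) j i = star (a j) * a i := by
    intro j i
    rw [CStarMatrix.mul_apply, Finset.sum_eq_single i₀]
    · simp [N, CStarMatrix.star_apply]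
    · intro k _ hk
      simp [N, CStarMatrix.star_apply, hk]
    · simp
  have hT : ∀ j i, (star N * N).map T j i = T (star (a j) * a i) := fun j i => by
    rw [CStarMatrix.map_apply, hN]
  simp only [← hT]
  exact CStarMatrix.re_sum_inner_nonneg (T.map_cstarMatrix_nonneg _ (star_mul_self_nonneg N)) x

/-- Since ‖c‖² - c*c = d*d for some d, the difference of the two sides is the kernel sum of the
family d aᵢ. Here d is only known to lie in B(H), so the estimate is made for the semigroup and
passed to the generator later. -/
theorem re_sum_inner_mul_le {ι : Type*} [Fintype ι] (c : H →L[ℂ] H) (a : ι → H →L[ℂ] H)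
    (x : ι → H) :
    (∑ i, ∑ j, ⟪T (star (c * a j) * (c * a i)) (x i), x j⟫).re ≤
      ‖c‖ ^ 2 * (∑ i, ∑ j, ⟪T (star (a j) * a i) (x i), x j⟫).re := by
  have h0 : 0 ≤ algebraMap ℝ (H →L[ℂ] H) (‖c‖ ^ 2) - star c * c := by
    rw [sub_nonneg, sq, ← CStarRing.norm_star_mul_self]
    exact IsSelfAdjoint.le_algebraMap_norm_self (IsSelfAdjoint.star_mul_self c)
  obtain ⟨d, hd⟩ := CStarAlgebra.nonneg_iff_eq_star_mul_self.1 h0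
  have h1 : ∀ i j, star (c * a j) * (c * a i)
      = ((‖c‖ ^ 2 : ℝ) : ℂ) • (star (a j) * a i) - star (d * a j) * (d * a i) := by
    intro i j
    have h2 : star c * c = ((‖c‖ ^ 2 : ℝ) : ℂ) • (1 : H →L[ℂ] H) - star d * d := by
      rw [← hd, Algebra.algebraMap_eq_smul_one, Complex.coe_smul]
      abel
    calc star (c * a j) * (c * a i) = star (a j) * (star c * c) * a i := by
          rw [star_mul]; noncomm_ring
      _ = _ := by
          rw [h2, star_mul, mul_sub, sub_mul, mul_smul_comm, smul_mul_assoc, mul_one]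
          noncomm_ring
  have h2 := T.re_sum_inner_nonneg (fun i => d * a i) x
  simp only [h1, map_sub, map_smul, sub_apply, smul_apply, inner_sub_left, inner_smul_left,
    Complex.conj_ofReal, Finset.sum_sub_distrib, ← Finset.mul_sum, Complex.sub_re,
    Complex.re_ofReal_mul]
  linarith

/-- The Stinespring dilation of a completely positive map on `B(H)`. -/
theorem exists_dilation :
    ∃ (K : Type u) (_ : NormedAddCommGroup K) (_ : InnerProductSpace ℂ K) (_ : CompleteSpace K)
      (V : H →L[ℂ] K) (π : (H →L[ℂ] H) →⋆ₐ[ℂ] (K →L[ℂ] K)),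
      (∀ A, ‖π A‖ ≤ ‖A‖) ∧ ∀ A, T A = adjoint V ∘L π A ∘L V :=
  exists_stinespring_dilation T.toLinearMap (fun A => ‖A‖) (fun _ => norm_nonneg _) T.map_star'
    (fun s x => by
      have h := T.re_sum_inner_nonneg (fun i : s => (i : H →L[ℂ] H)) (fun i => x i)
      rwa [Finset.sum_sum_coe_sort s fun a b => ⟪T (star b * a) (x a), x b⟫] at h)
    (fun c s x => by
      have h := T.re_sum_inner_mul_le c (fun i : s => (i : H →L[ℂ] H)) (fun i => x i)
      rwa [Finset.sum_sum_coe_sort s fun a b => ⟪T (star b * a) (x a), x b⟫,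
        Finset.sum_sum_coe_sort s fun a b => ⟪T (star (c * b) * (c * a)) (x a), x b⟫] at h)

end CompletelyPositiveMap

/-! ### Unital maps: contractivity and the defect of multiplicativity -/

namespace CompletelyPositiveMap

variable {H : Type u} [NormedAddCommGroup H] [InnerProductSpace ℂ H] [CompleteSpace H]
  {T : (H →L[ℂ] H) →CP (H →L[ℂ] H)}

theorem adjoint_comp_self_of_dilation (hT : T 1 = 1) {K : Type u} [NormedAddCommGroup K]
    [InnerProductSpace ℂ K] [CompleteSpace K] {V : H →L[ℂ] K}
    {π : (H →L[ℂ] H) →⋆ₐ[ℂ] (K →L[ℂ] K)} (hV : ∀ A, T A = adjoint V ∘L π A ∘L V) (x : H) :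
    adjoint V (V x) = x := by
  have h := hV 1
  rw [hT, _root_.map_one] at h
  exact (DFunLike.congr_fun h x).symm

theorem norm_apply_of_dilation (hT : T 1 = 1) {K : Type u} [NormedAddCommGroup K]
    [InnerProductSpace ℂ K] [CompleteSpace K] {V : H →L[ℂ] K}
    {π : (H →L[ℂ] H) →⋆ₐ[ℂ] (K →L[ℂ] K)} (hV : ∀ A, T A = adjoint V ∘L π A ∘L V) (x : H) :
    ‖V x‖ = ‖x‖ := by
  rw [← sq_eq_sq₀ (norm_nonneg _) (norm_nonneg _), ← inner_self_eq_norm_sq (𝕜 := ℂ),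
    ← adjoint_inner_left, adjoint_comp_self_of_dilation hT hV, inner_self_eq_norm_sq]

theorem norm_adjoint_le_of_dilation (hT : T 1 = 1) {K : Type u} [NormedAddCommGroup K]
    [InnerProductSpace ℂ K] [CompleteSpace K] {V : H →L[ℂ] K}
    {π : (H →L[ℂ] H) →⋆ₐ[ℂ] (K →L[ℂ] K)} (hV : ∀ A, T A = adjoint V ∘L π A ∘L V) :
    ‖adjoint V‖ ≤ 1 := by
  rw [LinearIsometryEquiv.norm_map]
  exact V.opNorm_le_bound zero_le_one fun x => by rw [norm_apply_of_dilation hT hV, one_mul]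

theorem norm_map_le (hT : T 1 = 1) (A : H →L[ℂ] H) : ‖T A‖ ≤ ‖A‖ := by
  obtain ⟨K, _, _, _, V, π, hπ, hV⟩ := T.exists_dilation
  refine (T A).opNorm_le_bound (norm_nonneg _) fun x => ?_
  rw [hV]
  calc ‖adjoint V (π A (V x))‖ ≤ 1 * ‖π A (V x)‖ :=
        (adjoint V).le_of_opNorm_le (norm_adjoint_le_of_dilation hT hV) _
    _ ≤ 1 * (‖A‖ * ‖V x‖) := by gcongr; exact (π A).le_of_opNorm_le (hπ A) _
    _ = ‖A‖ * ‖x‖ := by rw [one_mul, norm_apply_of_dilation hT hV]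

variable (T) in
/-- The size of the failure of multiplicativity of `T` at `A`. -/
noncomputable def defect (A : H →L[ℂ] H) : ℝ :=
  √‖T (star A * A) - star (T A) * T A‖

theorem defect_nonneg (A : H →L[ℂ] H) : 0 ≤ T.defect A := Real.sqrt_nonneg _

/-- With T = V*π(·)V and V isometric, Q(A) = (1 - VV*) π(A) V measures how far π(A) moves the range
of V out of itself. It turns the defect into an operator norm of a linear map, from which all its
inequalities follow. -/
theorem exists_defect_map (hT : T 1 = 1) :
    ∃ (K : Type u) (_ : NormedAddCommGroup K) (_ : InnerProductSpace ℂ K) (_ : CompleteSpace K)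
      (Q : (H →L[ℂ] H) →ₗ[ℂ] (H →L[ℂ] K)),
      (∀ A B, T (star A * B) - star (T A) * T B = adjoint (Q A) ∘L Q B) ∧
      (∀ A, T.defect A = ‖Q A‖) ∧ ∀ A B, ‖Q (A * B)‖ ≤ ‖A‖ * ‖Q B‖ + ‖Q A‖ * ‖B‖ := by
  obtain ⟨K, _, _, _, V, π, hπ, hV⟩ := T.exists_dilation
  let q : K →L[ℂ] K := 1 - V ∘L adjoint V
  have hVV : ∀ x, adjoint V (V x) = x := adjoint_comp_self_of_dilation hT hV
  have hqV : ∀ z, adjoint V (q z) = 0 := fun z => by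
    change adjoint V (z - V (adjoint V z)) = 0
    rw [map_sub, hVV, sub_self]
  have hq : ∀ z w, ⟪q z, q w⟫ = ⟪z, q w⟫ := fun z w => by
    change ⟪z - V (adjoint V z), q w⟫ = _
    rw [inner_sub_left, ← adjoint_inner_right, hqV, inner_zero_right, sub_zero]
  have hqn : ‖q‖ ≤ 1 := q.opNorm_le_bound zero_le_one fun z => by
    rw [one_mul]
    by_cases h0 : ‖q z‖ = 0
    · rw [h0]
      exact norm_nonneg _
    refine le_of_mul_le_mul_right ?_ (lt_of_le_of_ne (norm_nonneg _) (Ne.symm h0))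
    rw [← sq, ← inner_self_eq_norm_sq (𝕜 := ℂ), hq]
    exact re_inner_le_norm _ _
  let Q : (H →L[ℂ] H) →ₗ[ℂ] (H →L[ℂ] K) :=
    { toFun := fun A => q ∘L π A ∘L V
      map_add' := fun A B => by ext x; simp
      map_smul' := fun c A => by ext x; simp }
  have hQ : ∀ A x, Q A x = q (π A (V x)) := fun _ _ => rfl
  have hmul : ∀ A B, T (star A * B) - star (T A) * T B = adjoint (Q A) ∘L Q B := by
    intro A B
    ext x
    refine ext_inner_left ℂ fun y => ?_
    rw [comp_apply, adjoint_inner_right, hQ, hQ, hq, sub_apply, inner_sub_right]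
    change _ = ⟪π A (V y), π B (V x) - V (adjoint V (π B (V x)))⟫
    rw [inner_sub_right]
    congr 1
    · rw [hV, map_mul, map_star]
      change ⟪y, adjoint V (star (π A) (π B (V x)))⟫ = _
      rw [adjoint_inner_right, star_eq_adjoint, adjoint_inner_right]
    · change ⟪y, star (T A) (T B x)⟫ = _
      rw [star_eq_adjoint, adjoint_inner_right, hV, hV]
      change ⟪adjoint V (π A (V y)), adjoint V (π B (V x))⟫ = _
      rw [adjoint_inner_left]
  refine ⟨K, inferInstance, inferInstance, inferInstance, Q, hmul, fun A => ?_, fun A B => ?_⟩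
  · rw [defect, hmul, norm_adjoint_comp_self, Real.sqrt_mul_self (norm_nonneg _)]
  · refine (Q (A * B)).opNorm_le_bound (by positivity) fun x => ?_
    -- From π(B)V = Q(B) + V T(B), the part outside and the part inside the range of V.
    have h1 : Q (A * B) x = q (π A (Q B x)) + Q A (T B x) := by
      rw [hQ, hQ, hQ, hV, map_mul]
      change q (π A (π B (V x))) = q (π A (π B (V x) - V (adjoint V (π B (V x)))))
        + q (π A (V (adjoint V (π B (V x)))))
      rw [map_sub, map_sub, sub_add_cancel]
    rw [h1]
    calc ‖q (π A (Q B x)) + Q A (T B x)‖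
        ≤ 1 * (‖A‖ * (‖Q B‖ * ‖x‖)) + ‖Q A‖ * (‖B‖ * ‖x‖) := by
          refine (norm_add_le _ _).trans (add_le_add ?_ ?_)
          · refine (q.le_of_opNorm_le hqn _).trans ?_
            gcongr
            refine ((π A).le_of_opNorm_le (hπ A) _).trans ?_
            gcongr
            exact (Q B).le_opNorm x
          · refine ((Q A).le_opNorm _).trans ?_
            gcongr
            exact (T B).le_of_opNorm_le (norm_map_le hT B) x
      _ = (‖A‖ * ‖Q B‖ + ‖Q A‖ * ‖B‖) * ‖x‖ := by ring

theorem defect_add_le (hT : T 1 = 1) (A B : H →L[ℂ] H) :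
    T.defect (A + B) ≤ T.defect A + T.defect B := by
  obtain ⟨K, _, _, _, Q, -, hQ, -⟩ := exists_defect_map hT
  rw [hQ, hQ, hQ, map_add]
  exact norm_add_le _ _

theorem defect_smul (hT : T 1 = 1) (c : ℂ) (A : H →L[ℂ] H) :
    T.defect (c • A) = ‖c‖ * T.defect A := by
  obtain ⟨K, _, _, _, Q, -, hQ, -⟩ := exists_defect_map hT
  rw [hQ, hQ, map_smul, norm_smul]

theorem defect_mul_le (hT : T 1 = 1) (A B : H →L[ℂ] H) :
    T.defect (A * B) ≤ ‖A‖ * T.defect B + T.defect A * ‖B‖ := by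
  obtain ⟨K, _, _, _, Q, -, hQ, hmul⟩ := exists_defect_map hT
  rw [hQ, hQ, hQ]
  exact hmul A B

theorem norm_map_star_mul_sub_le (hT : T 1 = 1) (A B : H →L[ℂ] H) :
    ‖T (star A * B) - star (T A) * T B‖ ≤ T.defect A * T.defect B := by
  obtain ⟨K, _, _, _, Q, h, hQ, -⟩ := exists_defect_map hT
  rw [hQ, hQ, h]
  refine (opNorm_comp_le _ _).trans_eq ?_
  rw [LinearIsometryEquiv.norm_map]

theorem defect_sq (A : H →L[ℂ] H) :
    T.defect A ^ 2 = ‖T (star A * A) - star (T A) * T A‖ :=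
  Real.sq_sqrt (norm_nonneg _)

end CompletelyPositiveMap

/-! ### Time integrals, the Favard class and closability -/

namespace QuantumMarkovSemigroup

open scoped ComplexOrder

variable {H : Type u} [NormedAddCommGroup H] [InnerProductSpace ℂ H] [CompleteSpace H]
  (S : QuantumMarkovSemigroup H)

theorem norm_apply_le (t : ℝ≥0) (A : H →L[ℂ] H) : ‖S.T t A‖ ≤ ‖A‖ :=
  CompletelyPositiveMap.norm_map_le (S.map_one t) A

theorem continuous_inner_orbit (A : H →L[ℂ] H) (x y : H) :
    Continuous fun r : ℝ => ⟪x, S.T r.toNNReal A y⟫ := by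
  have h : Continuous fun t : ℝ≥0 => ⟪x, S.T t A y⟫ :=
    @Continuous.comp _ _ _ _ (sigmaWeakTopology H) _ _ _ (isNormal_inner x y) (S.time_continuous A)
  exact h.comp continuous_real_toNNReal

theorem intervalIntegrable_inner_orbit (A : H →L[ℂ] H) (x y : H) (a b : ℝ) :
    IntervalIntegrable (fun r : ℝ => ⟪x, S.T r.toNNReal A y⟫) MeasureTheory.volume a b :=
  (S.continuous_inner_orbit A x y).intervalIntegrable a b

theorem isNormal_inner_apply (t : ℝ≥0) (x y : H) : IsNormal fun A => ⟪x, S.T t A y⟫ :=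
  @Continuous.comp _ _ _ (sigmaWeakTopology H) (sigmaWeakTopology H) _ _ _ (isNormal_inner x y)
    (S.sigmaWeak_continuous t)

/-- The functional `A ↦ ∫₀ˢ ⟨x, T_r A y⟩ dr`. -/
noncomputable def timeIntegral (s : ℝ) (x y : H) : (H →L[ℂ] H) →ₗ[ℂ] ℂ where
  toFun A := ∫ r in (0 : ℝ)..s, ⟪x, S.T r.toNNReal A y⟫
  map_add' A B := by
    simp only [map_add, add_apply, inner_add_right]
    exact intervalIntegral.integral_add (S.intervalIntegrable_inner_orbit A x y 0 s)
      (S.intervalIntegrable_inner_orbit B x y 0 s)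
  map_smul' c A := by
    simp only [map_smul, smul_apply, inner_smul_right, RingHom.id_apply, smul_eq_mul]
    exact intervalIntegral.integral_const_mul _ _

theorem timeIntegral_apply (s : ℝ) (x y : H) (A : H →L[ℂ] H) :
    S.timeIntegral s x y A = ∫ r in (0 : ℝ)..s, ⟪x, S.T r.toNNReal A y⟫ := rfl

theorem norm_timeIntegral_le {s : ℝ} (hs : 0 ≤ s) (x y : H) (A : H →L[ℂ] H) :
    ‖S.timeIntegral s x y A‖ ≤ ‖x‖ * ‖A‖ * ‖y‖ * s := by
  rw [timeIntegral_apply]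
  refine (intervalIntegral.norm_integral_le_of_norm_le_const (C := ‖x‖ * ‖A‖ * ‖y‖)
    fun r _ => ?_).trans_eq (by rw [sub_zero, abs_of_nonneg hs])
  rw [mul_assoc]
  refine (norm_inner_le_norm _ _).trans ?_
  gcongr
  exact (S.T _ A).le_of_opNorm_le (S.norm_apply_le _ A) y

theorem inner_apply_nonneg (t : ℝ≥0) (x : H) {A : H →L[ℂ] H} (hA : 0 ≤ A) :
    0 ≤ ⟪x, S.T t A x⟫ := by
  have h : 0 ≤ S.T t A := by
    have := OrderHomClass.mono (S.T t) hA
    rwa [map_zero] at this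
  exact ((nonneg_iff_isPositive _).1 h).inner_nonneg_right x

theorem timeIntegral_eq_ofReal (s : ℝ) (x : H) {A : H →L[ℂ] H} (hA : 0 ≤ A) :
    S.timeIntegral s x x A = ((∫ r in (0 : ℝ)..s, (⟪x, S.T r.toNNReal A x⟫).re : ℝ) : ℂ) := by
  rw [timeIntegral_apply, ← intervalIntegral.integral_ofReal]
  exact intervalIntegral.integral_congr fun r _ =>
    (Complex.eq_re_of_ofReal_le (S.inner_apply_nonneg r.toNNReal x hA))

/-- The positive functional `A ↦ ∫₀ˢ ⟨x, T_r A x⟩ dr`. -/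
noncomputable def positiveTimeIntegral {s : ℝ} (hs : 0 ≤ s) (x : H) : (H →L[ℂ] H) →ₚ[ℂ] ℂ :=
  PositiveLinearMap.mk₀ (S.timeIntegral s x x) fun A hA => by
    rw [S.timeIntegral_eq_ofReal s x hA, Complex.zero_le_real]
    exact intervalIntegral.integral_nonneg hs fun r _ =>
      (Complex.nonneg_iff.1 (S.inner_apply_nonneg _ x hA)).1

/-- Dini's theorem: for fixed r the integrand decreases to 0 along the net of finite sets, by
normality of T_r, and it is continuous in r, so convergence is uniform on [0, s]. Dominated
convergence is not available along such a net. -/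
theorem tendsto_timeIntegral_one_sub_finProj {ι : Type*} (b : HilbertBasis ι ℂ H) {s : ℝ}
    (hs : 0 ≤ s) (x : H) :
    Tendsto (fun F => S.timeIntegral s x x (1 - b.finProj F)) atTop (𝓝 0) := by
  have hdini : TendstoUniformlyOn
      (fun (F : Finset ι) (r : ℝ) => (⟪x, S.T r.toNNReal (1 - b.finProj F) x⟫).re)
      (fun _ => 0) atTop (Set.Icc 0 s) := by
    refine Antitone.tendstoUniformlyOn_of_forall_tendsto isCompact_Icc
      (fun F => (Complex.continuous_re.comp (S.continuous_inner_orbit _ x x)).continuousOn)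
      (fun r _ F G hFG => ?_) continuousOn_const fun r _ => ?_
    · have h := S.inner_apply_nonneg r.toNNReal x (sub_nonneg.2 (b.finProj_mono hFG))
      have h' := (Complex.nonneg_iff.1 h).1
      simp only [map_sub, sub_apply, inner_sub_right, Complex.sub_re] at h' ⊢
      linarith
    · have h := (S.isNormal_inner_apply r.toNNReal x x).tendsto b.sigmaWeakTendsto_one_sub_finProj
      simpa only [Function.comp_def, map_zero, zero_apply, inner_zero_right, Complex.zero_re] using
        (Complex.continuous_re.tendsto _).comp h
  rw [Metric.tendstoUniformlyOn_iff] at hdini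
  rw [Metric.tendsto_nhds]
  intro ε hε
  -- Dividing by s + 1 instead of s covers s = 0 as well.
  filter_upwards [hdini (ε / (s + 1)) (by positivity)] with F hF
  rw [dist_zero_right, S.timeIntegral_eq_ofReal s x (b.one_sub_finProj_nonneg F),
    Complex.norm_real]
  refine (intervalIntegral.norm_integral_le_of_norm_le_const (C := ε / (s + 1))
    fun r hr => ?_).trans_lt ?_
  · rw [Set.uIoc_of_le hs] at hr
    have := hF r ⟨hr.1.le, hr.2⟩
    rw [dist_zero_left] at this
    exact this.le
  · rw [sub_zero, abs_of_nonneg hs, div_mul_eq_mul_div, div_lt_iff₀ (by positivity)]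
    nlinarith

/-- Time averages of the predual orbit of a vector functional are normal. -/
theorem isNormal_timeIntegral {s : ℝ} (hs : 0 ≤ s) (x y : H) : IsNormal (S.timeIntegral s x y) := by
  obtain ⟨w, b, -⟩ := exists_hilbertBasis ℂ H
  have hdiag : ∀ z, IsNormal (S.timeIntegral s z z) := fun z =>
    PositiveLinearMap.isNormal_of_tendsto b (S.positiveTimeIntegral hs z)
      (S.tendsto_timeIntegral_one_sub_finProj b hs z)
  -- The normality criterion applies to positive functionals, that is, to x = y; polarization gives
  -- the rest.
  have hpol : (S.timeIntegral s x y : (H →L[ℂ] H) → ℂ) = fun A =>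
      (1 / 4 : ℂ) * S.timeIntegral s (x + y) (x + y) A
      + (-1 / 4 : ℂ) * S.timeIntegral s (x - y) (x - y) A
      + (Complex.I / 4) * S.timeIntegral s (x - Complex.I • y) (x - Complex.I • y) A
      + (-Complex.I / 4) * S.timeIntegral s (x + Complex.I • y) (x + Complex.I • y) A := by
    funext A
    have hi := fun z => S.intervalIntegrable_inner_orbit A z z 0 s
    simp only [timeIntegral_apply]
    simp_rw [fun r : ℝ => inner_apply_polarization (S.T r.toNNReal A) x y]
    rw [intervalIntegral.integral_add _ ((hi _).const_mul _),
      intervalIntegral.integral_add _ ((hi _).const_mul _),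
      intervalIntegral.integral_add ((hi _).const_mul _) ((hi _).const_mul _)]
    · simp only [intervalIntegral.integral_const_mul]
    · exact ((hi _).const_mul _).add ((hi _).const_mul _)
    · exact (((hi _).const_mul _).add ((hi _).const_mul _)).add ((hi _).const_mul _)
  rw [hpol]
  exact ((((hdiag _).const_mul _).add ((hdiag _).const_mul _)).add ((hdiag _).const_mul _)).add
    ((hdiag _).const_mul _)

/-- The difference quotient `(T_t A - A) / t`. -/
noncomputable def diffQuotient (A : H →L[ℂ] H) (t : ℝ≥0) : H →L[ℂ] H :=
  ((t : ℝ) : ℂ)⁻¹ • (S.T t A - A)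

/-- By T_r T_t = T_{r+t} the integral of the difference quotient telescopes to two boundary
averages, over [s, s+t] and [0, t]. They tend to the values at s and 0 for every A, whether or not A
is in D(L). -/
theorem timeIntegral_diffQuotient {s : ℝ} (hs : 0 ≤ s) (x y : H) (A : H →L[ℂ] H) (t : ℝ≥0) :
    S.timeIntegral s x y (S.diffQuotient A t) = (t : ℝ)⁻¹ •
      (S.timeIntegral (s + t) x y A - S.timeIntegral s x y A)
      - (t : ℝ)⁻¹ • (S.timeIntegral (0 + t) x y A - S.timeIntegral 0 x y A) := by
  have hi := S.intervalIntegrable_inner_orbit A x y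
  have h1 : S.timeIntegral s x y (S.T t A) = ∫ r in (0 + t : ℝ)..(s + t), ⟪x, S.T r.toNNReal A y⟫ := by
    rw [timeIntegral_apply,
      ← intervalIntegral.integral_comp_add_right (fun r : ℝ => ⟪x, S.T r.toNNReal A y⟫) (t : ℝ)]
    refine intervalIntegral.integral_congr fun r hr => ?_
    rw [Set.uIcc_of_le hs] at hr
    simp only [← S.map_time_add, Real.toNNReal_add hr.1 t.coe_nonneg, Real.toNNReal_coe]
  have h2 := intervalIntegral.integral_interval_sub_left (hi 0 (s + t)) (hi 0 (0 + t))
  rw [diffQuotient, map_smul, map_sub, h1, ← h2, ← timeIntegral_apply, ← timeIntegral_apply,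
    timeIntegral_apply S 0, intervalIntegral.integral_same, smul_eq_mul, Complex.real_smul,
    Complex.real_smul, Complex.ofReal_inv]
  ring

theorem hasDerivAt_timeIntegral (s : ℝ) (x y : H) (A : H →L[ℂ] H) :
    HasDerivAt (fun s => S.timeIntegral s x y A) ⟪x, S.T s.toNNReal A y⟫ s :=
  (S.continuous_inner_orbit A x y).integral_hasStrictDerivAt 0 s |>.hasDerivAt

theorem tendsto_slope_timeIntegral (s : ℝ) (x y : H) (A : H →L[ℂ] H) :
    Tendsto (fun t : ℝ≥0 => (t : ℝ)⁻¹ •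
      (S.timeIntegral (s + t) x y A - S.timeIntegral s x y A)) (𝓝[>] 0)
      (𝓝 ⟪x, S.T s.toNNReal A y⟫) := by
  have h := (S.hasDerivAt_timeIntegral s x y A).tendsto_slope_zero_right
  refine h.comp ?_
  refine tendsto_nhdsWithin_iff.2 ⟨?_, ?_⟩
  · have : Tendsto (fun t : ℝ≥0 => (t : ℝ)) (𝓝 0) (𝓝 0) := NNReal.continuous_coe.tendsto 0
    exact this.mono_left nhdsWithin_le_nhds
  · filter_upwards [self_mem_nhdsWithin] with t ht
    exact NNReal.coe_pos.2 ht

/-- If the difference quotients of `A` converge to `B` along some filter, then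
`T_s A - A = ∫₀ˢ T_r B dr` weakly. -/
theorem inner_sub_eq_timeIntegral {l : Filter ℝ≥0} [l.NeBot] (hl : l ≤ 𝓝[>] 0)
    {A B : H →L[ℂ] H} (hAB : SigmaWeakTendsto (S.diffQuotient A) l B) (s : ℝ≥0) (x y : H) :
    ⟪x, (S.T s A - A) y⟫ = S.timeIntegral s x y B := by
  -- Normality of the time integral is what lets the limit of the quotients pass under the integral.
  have h1 := (S.isNormal_timeIntegral s.coe_nonneg x y).tendsto hAB
  have h2 := ((S.tendsto_slope_timeIntegral s x y A).sub
    (S.tendsto_slope_timeIntegral 0 x y A)).mono_left hl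
  have h3 := tendsto_nhds_unique h1
    (h2.congr fun t => (S.timeIntegral_diffQuotient s.coe_nonneg x y A t).symm)
  rw [h3, Real.toNNReal_coe, Real.toNNReal_zero, S.map_time_zero, sub_apply, inner_sub_right]

variable {S}

theorem HasGeneratorAt.inner_sub_eq_timeIntegral {A B : H →L[ℂ] H} (h : S.HasGeneratorAt A B)
    (s : ℝ≥0) (x y : H) : ⟪x, (S.T s A - A) y⟫ = S.timeIntegral s x y B :=
  S.inner_sub_eq_timeIntegral le_rfl h s x y

theorem norm_sub_le_of_inner_eq {A B : H →L[ℂ] H} {s : ℝ≥0}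
    (h : ∀ x y, ⟪x, (S.T s A - A) y⟫ = S.timeIntegral s x y B) : ‖S.T s A - A‖ ≤ ‖B‖ * s := by
  refine opNorm_le_of_re_inner_le (𝕜 := ℂ) (by positivity) fun y x hy hx => ?_
  rw [inner_re_symm]
  refine (RCLike.re_le_norm _).trans ?_
  rw [h]
  simpa [hx, hy] using S.norm_timeIntegral_le s.coe_nonneg x y B

theorem HasGeneratorAt.norm_sub_le {A B : H →L[ℂ] H} (h : S.HasGeneratorAt A B) (s : ℝ≥0) :
    ‖S.T s A - A‖ ≤ ‖B‖ * s :=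
  norm_sub_le_of_inner_eq (h.inner_sub_eq_timeIntegral s)

/-- The formula bounds the quotients by ‖B‖ and, by the fundamental theorem of calculus, gives weak
operator convergence; for bounded families this is σ-weak convergence. -/
theorem HasGeneratorAt.of_inner_eq {A B : H →L[ℂ] H}
    (h : ∀ (s : ℝ≥0) x y, ⟪x, (S.T s A - A) y⟫ = S.timeIntegral s x y B) :
    S.HasGeneratorAt A B := by
  refine sigmaWeakTendsto_of_bounded (M := ‖B‖) ?_ fun x y => ?_
  · filter_upwards [self_mem_nhdsWithin] with t ht
    have ht' : (0 : ℝ) < t := NNReal.coe_pos.2 ht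
    rw [norm_smul, norm_inv, Complex.norm_real, Real.norm_of_nonneg ht'.le,
      inv_mul_le_iff₀ ht', mul_comm]
    exact norm_sub_le_of_inner_eq (h t)
  · have h1 := S.tendsto_slope_timeIntegral 0 x y B
    rw [Real.toNNReal_zero, S.map_time_zero] at h1
    refine h1.congr fun t => ?_
    rw [smul_apply, inner_smul_right, h, zero_add, timeIntegral_apply S 0,
      intervalIntegral.integral_same, sub_zero, Complex.real_smul, Complex.ofReal_inv]

variable (S) in
/-- The domain of the generator is the Favard class of the semigroup. -/
theorem mem_generator_domain_iff {A : H →L[ℂ] H} :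
    A ∈ S.generator.domain ↔ ∃ M : ℝ, ∀ t : ℝ≥0, ‖S.T t A - A‖ ≤ M * t := by
  refine ⟨fun ⟨B, hB⟩ => ⟨‖B‖, hB.norm_sub_le⟩, fun ⟨M, hM⟩ => ?_⟩
  let l := Ultrafilter.of (𝓝[>] (0 : ℝ≥0))
  have hl : (l : Filter ℝ≥0) ≤ 𝓝[>] 0 := Ultrafilter.of_le _
  have hbd : ∀ᶠ t in 𝓝[>] (0 : ℝ≥0), ‖S.diffQuotient A t‖ ≤ M := by
    filter_upwards [self_mem_nhdsWithin] with t ht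
    have ht' : (0 : ℝ) < t := NNReal.coe_pos.2 ht
    rw [diffQuotient, norm_smul, norm_inv, Complex.norm_real, Real.norm_of_nonneg ht'.le,
      inv_mul_le_iff₀ ht', mul_comm]
    exact hM t
  obtain ⟨B, hB⟩ := exists_sigmaWeakTendsto_of_ultrafilter l (hl hbd)
  exact ⟨B, .of_inner_eq (S.inner_sub_eq_timeIntegral hl hB)⟩

/-- The generator is `σ`-weakly closable. -/
theorem eq_zero_of_tendsto_generator {ι : Type*} {l : Filter ι} [l.NeBot]
    {A B : ι → H →L[ℂ] H} {C : H →L[ℂ] H} (hAB : ∀ i, S.HasGeneratorAt (A i) (B i))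
    (hA : SigmaWeakTendsto A l 0) (hB : SigmaWeakTendsto B l C) : C = 0 := by
  have h0 : ∀ (s : ℝ≥0) x y, S.timeIntegral s x y C = 0 := by
    intro s x y
    have h1 := (S.isNormal_timeIntegral s.coe_nonneg x y).tendsto hB
    have h2 := ((S.isNormal_inner_apply s x y).tendsto hA).sub ((isNormal_inner x y).tendsto hA)
    simp only [map_zero, zero_apply, inner_zero_right, sub_self] at h2
    refine tendsto_nhds_unique h1 (h2.congr fun i => ?_)
    rw [← inner_sub_right, ← sub_apply]
    exact (hAB i).inner_sub_eq_timeIntegral s x y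
  -- All time integrals of C vanish, so C satisfies the integral formula for A = 0 and equals L(0).
  have hC : S.HasGeneratorAt 0 C := .of_inner_eq fun s x y => by
    rw [h0, map_zero, sub_zero, zero_apply, inner_zero_right]
  exact hC.unique hasGeneratorAt_zero

end QuantumMarkovSemigroup

/-! ### The domain algebra is a unital *-algebra -/

namespace QuantumMarkovSemigroup

variable {H : Type u} [NormedAddCommGroup H] [InnerProductSpace ℂ H] [CompleteSpace H]
  (S : QuantumMarkovSemigroup H)

/-- The squared defect of multiplicativity at `A` is `O(t)`. -/
def HasLinearDefect (A : H →L[ℂ] H) : Prop :=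
  ∃ M : ℝ, ∀ t : ℝ≥0, (S.T t).defect A ^ 2 ≤ M * t

variable {S}

theorem star_mem_generator_domain {A : H →L[ℂ] H} (hA : A ∈ S.generator.domain) :
    star A ∈ S.generator.domain := by
  obtain ⟨M, hM⟩ := S.mem_generator_domain_iff.1 hA
  refine S.mem_generator_domain_iff.2 ⟨M, fun t => ?_⟩
  rw [CompletelyPositiveMap.map_star', ← star_sub, norm_star]
  exact hM t

theorem exists_norm_star_mul_sub_le {A B : H →L[ℂ] H} (hA : A ∈ S.generator.domain)
    (hB : B ∈ S.generator.domain) :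
    ∃ M : ℝ, ∀ t : ℝ≥0, ‖star (S.T t A) * S.T t B - star A * B‖ ≤ M * t := by
  obtain ⟨M, hM⟩ := S.mem_generator_domain_iff.1 hA
  obtain ⟨M', hM'⟩ := S.mem_generator_domain_iff.1 hB
  refine ⟨M * ‖B‖ + ‖A‖ * M', fun t => ?_⟩
  have h : star (S.T t A) * S.T t B - star A * B
      = star (S.T t A - A) * S.T t B + star A * (S.T t B - B) := by
    rw [star_sub]; noncomm_ring
  rw [h]
  calc ‖star (S.T t A - A) * S.T t B + star A * (S.T t B - B)‖
      ≤ ‖S.T t A - A‖ * ‖S.T t B‖ + ‖A‖ * ‖S.T t B - B‖ := by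
        refine (norm_add_le _ _).trans (add_le_add ?_ ?_) <;>
        · refine (norm_mul_le _ _).trans_eq ?_
          rw [norm_star]
    _ ≤ (M * t) * ‖B‖ + ‖A‖ * (M' * t) := by
        gcongr
        · exact (norm_nonneg _).trans (hM t)
        · exact hM t
        · exact S.norm_apply_le t B
        · exact hM' t
    _ = (M * ‖B‖ + ‖A‖ * M') * t := by ring

/-- T_t(A*B) - A*B is the failure of multiplicativity, at most a product of two defects of order √t,
plus T_t(A)*T_t(B) - A*B, which is O(t) by the Leibniz rule. -/
theorem star_mul_mem_generator_domain {A B : H →L[ℂ] H} (hA : A ∈ S.generator.domain)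
    (hB : B ∈ S.generator.domain) (hdA : S.HasLinearDefect A) (hdB : S.HasLinearDefect B) :
    star A * B ∈ S.generator.domain := by
  obtain ⟨M, hM⟩ := exists_norm_star_mul_sub_le hA hB
  obtain ⟨a, ha⟩ := hdA
  obtain ⟨b, hb⟩ := hdB
  refine S.mem_generator_domain_iff.2 ⟨a + b + M, fun t => ?_⟩
  have h := CompletelyPositiveMap.norm_map_star_mul_sub_le (S.map_one t) A B
  have h' : S.T t (star A * B) - star A * B = (S.T t (star A * B) - star (S.T t A) * S.T t B)
      + (star (S.T t A) * S.T t B - star A * B) := by abel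
  rw [h']
  refine (norm_add_le _ _).trans ?_
  nlinarith [ha t, hb t, hM t, sq_nonneg ((S.T t).defect A - (S.T t).defect B),
    sq_nonneg ((S.T t).defect A), sq_nonneg ((S.T t).defect B)]

theorem hasLinearDefect_iff {A : H →L[ℂ] H} (hA : A ∈ S.generator.domain) :
    S.HasLinearDefect A ↔ star A * A ∈ S.generator.domain := by
  refine ⟨fun h => star_mul_mem_generator_domain hA hA h h, fun h => ?_⟩
  obtain ⟨M, hM⟩ := exists_norm_star_mul_sub_le hA hA
  obtain ⟨M', hM'⟩ := S.mem_generator_domain_iff.1 h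
  refine ⟨M' + M, fun t => ?_⟩
  rw [CompletelyPositiveMap.defect_sq, add_mul]
  have h' : S.T t (star A * A) - star (S.T t A) * S.T t A = (S.T t (star A * A) - star A * A)
      - (star (S.T t A) * S.T t A - star A * A) := by abel
  rw [h']
  exact (norm_sub_le _ _).trans (add_le_add (hM' t) (hM t))

theorem HasLinearDefect.add {A B : H →L[ℂ] H} (hA : S.HasLinearDefect A)
    (hB : S.HasLinearDefect B) : S.HasLinearDefect (A + B) := by
  obtain ⟨a, ha⟩ := hA
  obtain ⟨b, hb⟩ := hB
  refine ⟨2 * a + 2 * b, fun t => ?_⟩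
  have h := CompletelyPositiveMap.defect_add_le (S.map_one t) A B
  have h0 := (S.T t).defect_nonneg (A + B)
  nlinarith [ha t, hb t, sq_nonneg ((S.T t).defect A - (S.T t).defect B)]

theorem HasLinearDefect.mul {A B : H →L[ℂ] H} (hA : S.HasLinearDefect A)
    (hB : S.HasLinearDefect B) : S.HasLinearDefect (A * B) := by
  obtain ⟨a, ha⟩ := hA
  obtain ⟨b, hb⟩ := hB
  refine ⟨2 * (‖A‖ ^ 2 * b) + 2 * (‖B‖ ^ 2 * a), fun t => ?_⟩
  have h := CompletelyPositiveMap.defect_mul_le (S.map_one t) A B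
  have h0 := (S.T t).defect_nonneg (A * B)
  calc (S.T t).defect (A * B) ^ 2
      ≤ (‖A‖ * (S.T t).defect B + (S.T t).defect A * ‖B‖) ^ 2 := by gcongr
    _ ≤ 2 * (‖A‖ ^ 2 * (S.T t).defect B ^ 2) + 2 * (‖B‖ ^ 2 * (S.T t).defect A ^ 2) := by
        nlinarith [sq_nonneg (‖A‖ * (S.T t).defect B - (S.T t).defect A * ‖B‖)]
    _ ≤ 2 * (‖A‖ ^ 2 * (b * t)) + 2 * (‖B‖ ^ 2 * (a * t)) := by
        gcongr
        · exact hb t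
        · exact ha t
    _ = _ := by ring

theorem hasLinearDefect_algebraMap (c : ℂ) :
    S.HasLinearDefect (algebraMap ℂ (H →L[ℂ] H) c) := by
  refine ⟨0, fun t => ?_⟩
  rw [Algebra.algebraMap_eq_smul_one, CompletelyPositiveMap.defect_smul (S.map_one t),
    CompletelyPositiveMap.defect]
  simp [S.map_one]

theorem algebraMap_mem_generator_domain (c : ℂ) :
    algebraMap ℂ (H →L[ℂ] H) c ∈ S.generator.domain := by
  refine S.mem_generator_domain_iff.2 ⟨0, fun t => ?_⟩
  rw [Algebra.algebraMap_eq_smul_one, map_smul, S.map_one]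
  simp

/-- Replaces the conditions on A*A and AA*, not visibly stable under sums and products, by defect
bounds that are. -/
theorem mem_domainAlgebra_iff {A : H →L[ℂ] H} :
    A ∈ S.domainAlgebra ↔
      A ∈ S.generator.domain ∧ S.HasLinearDefect A ∧ S.HasLinearDefect (star A) := by
  refine and_congr_right fun hA => and_congr (hasLinearDefect_iff hA).symm ?_
  rw [hasLinearDefect_iff (star_mem_generator_domain hA), star_star]
  rfl

variable (S)

/-- The domain algebra of the generator, as a unital `*`-subalgebra of `B(H)`. -/
def domainStarSubalgebra : StarSubalgebra ℂ (H →L[ℂ] H) where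
  carrier := S.domainAlgebra
  mul_mem' {A B} hA hB := by
    rw [mem_domainAlgebra_iff] at *
    refine ⟨?_, hA.2.1.mul hB.2.1, ?_⟩
    · have h := star_mul_mem_generator_domain (star_mem_generator_domain hA.1) hB.1 hA.2.2 hB.2.1
      rwa [star_star] at h
    · rw [star_mul]
      exact hB.2.2.mul hA.2.2
  add_mem' {A B} hA hB := by
    rw [mem_domainAlgebra_iff] at *
    refine ⟨add_mem hA.1 hB.1, hA.2.1.add hB.2.1, ?_⟩
    rw [star_add]
    exact hA.2.2.add hB.2.2
  algebraMap_mem' c := by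
    rw [mem_domainAlgebra_iff]
    refine ⟨algebraMap_mem_generator_domain c, hasLinearDefect_algebraMap c, ?_⟩
    rw [← algebraMap_star_comm]
    exact hasLinearDefect_algebraMap _
  star_mem' {A} hA := by
    change star A ∈ S.domainAlgebra
    have hA' : A ∈ S.domainAlgebra := hA
    rw [mem_domainAlgebra_iff] at *
    rw [star_star]
    exact ⟨star_mem_generator_domain hA'.1, hA'.2.2, hA'.2.1⟩

end QuantumMarkovSemigroup

/-! ### σ-weak continuity of A ↦ GA + AG* -/

section Multiplication

variable {H : Type u} [NormedAddCommGroup H] [InnerProductSpace ℂ H]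

theorem summable_norm_sq_apply {x : ℕ → H} (hx : Summable fun n => ‖x n‖ ^ 2) (G : H →L[ℂ] H) :
    Summable fun n => ‖G (x n)‖ ^ 2 := by
  refine Summable.of_nonneg_of_le (fun _ => by positivity) (fun n => ?_) (hx.mul_left (‖G‖ ^ 2))
  rw [← mul_pow]
  gcongr
  exact G.le_opNorm _

theorem continuous_sigmaWeak_mul_add_mul_adjoint [CompleteSpace H] (G : H →L[ℂ] H) :
    @Continuous _ _ (sigmaWeakTopology H) (sigmaWeakTopology H)
      fun A : H →L[ℂ] H => G ∘L A + A ∘L adjoint G := by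
  refine continuous_iInf_rng.2 fun x => continuous_iInf_rng.2 fun y =>
    continuous_iInf_rng.2 fun hx => continuous_iInf_rng.2 fun hy => continuous_induced_rng.2 ?_
  have h1 := isNormal_tsum_nat (summable_norm_sq_apply hx (adjoint G)) hy
  have h2 := isNormal_tsum_nat hx (summable_norm_sq_apply hy (adjoint G))
  have h3 := h1.add h2
  refine Eq.mp (congrArg IsNormal (funext fun A => ?_)) h3
  rw [Function.comp_apply, ← (summable_inner_apply (summable_norm_sq_apply hx _) hy A).tsum_add
    (summable_inner_apply hx (summable_norm_sq_apply hy _) A)]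
  refine tsum_congr fun n => ?_
  rw [adjoint_inner_left, add_apply, inner_add_right]
  rfl

end Multiplication

/-! ### Conditional complete positivity of the generator -/

namespace QuantumMarkovSemigroup

variable {H : Type u} [NormedAddCommGroup H] [InnerProductSpace ℂ H] [CompleteSpace H]
  (S : QuantumMarkovSemigroup H)

/-- The generator, restricted to the domain algebra. -/
noncomputable def algebraGenerator : S.domainStarSubalgebra →ₗ[ℂ] (H →L[ℂ] H) where
  toFun A := S.generator ⟨A, A.2.1⟩
  map_add' A B := S.generator.map_add ⟨A, A.2.1⟩ ⟨B, B.2.1⟩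
  map_smul' c A := S.generator.map_smul c ⟨A, A.2.1⟩

theorem hasGeneratorAt_algebraGenerator (A : S.domainStarSubalgebra) :
    S.HasGeneratorAt A (S.algebraGenerator A) := S.generator_spec ⟨A, A.2.1⟩

theorem algebraGenerator_star (A : S.domainStarSubalgebra) :
    S.algebraGenerator (star A) = star (S.algebraGenerator A) := by
  ext y
  refine ext_inner_left ℂ fun x => ?_
  have h1 := SigmaWeakTendsto.inner (S.hasGeneratorAt_algebraGenerator (star A)) x y
  have h2 := (SigmaWeakTendsto.inner (S.hasGeneratorAt_algebraGenerator A) y x).star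
  rw [star_eq_adjoint, adjoint_inner_right, ← inner_conj_symm _ y]
  refine tendsto_nhds_unique h1 (h2.congr fun t => ?_)
  rw [StarMemClass.coe_star, CompletelyPositiveMap.map_star', ← star_sub, star_eq_adjoint,
    smul_apply, smul_apply, inner_smul_right, inner_smul_right, adjoint_inner_right,
    ← inner_conj_symm _ y, star_mul, ← Complex.ofReal_inv]
  simp [mul_comm]

/-- On families with `∑ᵢ aᵢ xᵢ = 0` the kernel of the generator is the derivative at `0` of the
kernel of the semigroup. -/
theorem tendsto_kernel_semigroup {ι : Type*} [Fintype ι] (a : ι → S.domainStarSubalgebra)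
    (x : ι → H) (h0 : ∑ i, (a i : H →L[ℂ] H) (x i) = 0) :
    Tendsto (fun t : ℝ≥0 => (t : ℝ)⁻¹ *
        (∑ i, ∑ j, ⟪S.T t (star (a j : H →L[ℂ] H) * a i) (x i), x j⟫).re) (𝓝[>] 0)
      (𝓝 (∑ i, ∑ j, ⟪S.algebraGenerator (star (a j) * a i) (x i), x j⟫).re) := by
  have h1 : Tendsto (fun t : ℝ≥0 => ∑ i, ∑ j,
      ⟪(((t : ℝ) : ℂ)⁻¹ • (S.T t (star (a j : H →L[ℂ] H) * a i) - star (a j : H →L[ℂ] H) * a i))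
        (x i), x j⟫) (𝓝[>] 0)
      (𝓝 (∑ i, ∑ j, ⟪S.algebraGenerator (star (a j) * a i) (x i), x j⟫)) := by
    refine tendsto_finsetSum _ fun i _ => tendsto_finsetSum _ fun j _ => ?_
    have h := (SigmaWeakTendsto.inner
      (S.hasGeneratorAt_algebraGenerator (star (a j) * a i)) (x j) (x i)).star
    simp only [RCLike.star_def, inner_conj_symm] at h
    exact h
  refine ((Complex.continuous_re.tendsto _).comp h1).congr fun t => ?_
  -- The kernel sum at t = 0 is ‖∑ aᵢ xᵢ‖² = 0, so the sum of the difference quotients is the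
  -- semigroup kernel sum divided by t.
  have h2 : ∑ i, ∑ j, ⟪(star (a j : H →L[ℂ] H) * a i) (x i), x j⟫ = 0 := by
    have h3 : ∀ i j, ⟪(star (a j : H →L[ℂ] H) * a i) (x i), x j⟫
        = ⟪(a i : H →L[ℂ] H) (x i), (a j : H →L[ℂ] H) (x j)⟫ := fun i j => by
      rw [mul_def, comp_apply, star_eq_adjoint, adjoint_inner_left]
    simp only [h3, ← inner_sum, h0, inner_zero_right,
      Finset.sum_const_zero]
  simp only [Function.comp_apply, smul_apply, sub_apply, inner_smul_left, inner_sub_left,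
    ← Finset.mul_sum, Finset.sum_sub_distrib, h2, sub_zero, ← Complex.ofReal_inv,
    Complex.conj_ofReal, Complex.re_ofReal_mul]

/-- The generator is conditionally completely positive. -/
theorem re_sum_inner_algebraGenerator_nonneg {ι : Type*} [Fintype ι]
    (a : ι → S.domainStarSubalgebra) (x : ι → H) (h0 : ∑ i, (a i : H →L[ℂ] H) (x i) = 0) :
    0 ≤ (∑ i, ∑ j, ⟪S.algebraGenerator (star (a j) * a i) (x i), x j⟫).re :=
  ge_of_tendsto' (S.tendsto_kernel_semigroup a x h0) fun t =>
    mul_nonneg (inv_nonneg.2 t.coe_nonneg) ((S.T t).re_sum_inner_nonneg _ x)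

theorem re_sum_inner_algebraGenerator_mul_le {ι : Type*} [Fintype ι]
    (c : S.domainStarSubalgebra) (a : ι → S.domainStarSubalgebra) (x : ι → H)
    (h0 : ∑ i, (a i : H →L[ℂ] H) (x i) = 0) :
    (∑ i, ∑ j, ⟪S.algebraGenerator (star (c * a j) * (c * a i)) (x i), x j⟫).re ≤
      ‖(c : H →L[ℂ] H)‖ ^ 2 *
        (∑ i, ∑ j, ⟪S.algebraGenerator (star (a j) * a i) (x i), x j⟫).re := by
  have h0' : ∑ i, ((c * a i : S.domainStarSubalgebra) : H →L[ℂ] H) (x i) = 0 := by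
    have : ∀ i, ((c * a i : S.domainStarSubalgebra) : H →L[ℂ] H) (x i)
        = (c : H →L[ℂ] H) ((a i : H →L[ℂ] H) (x i)) := fun _ => rfl
    simp only [this, ← map_sum, h0, map_zero]
  refine le_of_tendsto_of_tendsto' (S.tendsto_kernel_semigroup (fun i => c * a i) x h0')
    ((S.tendsto_kernel_semigroup a x h0).const_mul _) fun t => ?_
  rw [mul_left_comm]
  exact mul_le_mul_of_nonneg_left
    ((S.T t).re_sum_inner_mul_le c (fun i => (a i : H →L[ℂ] H)) x) (inv_nonneg.2 t.coe_nonneg)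

variable (k : H)

/-- The subspace of all `x` for which `|x⟩⟨k|` lies in the domain algebra. -/
def domainVectorSubmodule : Submodule ℂ H where
  carrier := S.domainVectors k
  add_mem' {x y} hx hy := by
    change InnerProductSpace.rankOne ℂ (x + y) k ∈ S.domainStarSubalgebra
    rw [map_add, add_apply]
    exact add_mem (s := S.domainStarSubalgebra) hx hy
  zero_mem' := by
    change InnerProductSpace.rankOne ℂ (0 : H) k ∈ S.domainStarSubalgebra
    rw [map_zero, zero_apply]
    exact zero_mem _
  smul_mem' c x hx := by
    change InnerProductSpace.rankOne ℂ (c • x) k ∈ S.domainStarSubalgebra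
    rw [map_smul, smul_apply]
    exact SMulMemClass.smul_mem (S := StarSubalgebra ℂ (H →L[ℂ] H)) (s := S.domainStarSubalgebra) c hx

variable {S k}

theorem apply_mem_domainVectorSubmodule (A : S.domainStarSubalgebra) {x : H}
    (hx : x ∈ S.domainVectorSubmodule k) :
    (A : H →L[ℂ] H) x ∈ S.domainVectorSubmodule k := by
  change InnerProductSpace.rankOne ℂ ((A : H →L[ℂ] H) x) k ∈ S.domainStarSubalgebra
  rw [← InnerProductSpace.comp_rankOne]
  exact mul_mem A.2 hx

/-- |k⟩⟨k| is self-adjoint and its square is a multiple of itself. -/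
theorem self_mem_domainVectorSubmodule
    (hk : InnerProductSpace.rankOne ℂ k k ∈ S.generator.domain) :
    k ∈ S.domainVectorSubmodule k := by
  refine ⟨hk, ?_, ?_⟩ <;>
  · rw [InnerProductSpace.adjoint_rankOne, InnerProductSpace.rankOne_comp_rankOne]
    exact Submodule.smul_mem _ _ hk

variable (S k) in
/-- The linear map `x ↦ |x⟩⟨k|` with values in the domain algebra. -/
noncomputable def ketbra : S.domainVectorSubmodule k →ₗ[ℂ] S.domainStarSubalgebra where
  toFun x := ⟨InnerProductSpace.rankOne ℂ (x : H) k, x.2⟩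
  map_add' x y := Subtype.ext <| by simp
  map_smul' c x := Subtype.ext <| by simp

theorem coe_ketbra (x : S.domainVectorSubmodule k) :
    (S.ketbra k x : H →L[ℂ] H) = InnerProductSpace.rankOne ℂ (x : H) k := rfl

theorem mul_ketbra (A : S.domainStarSubalgebra) (x : S.domainVectorSubmodule k) :
    A * S.ketbra k x = S.ketbra k ⟨(A : H →L[ℂ] H) x, apply_mem_domainVectorSubmodule A x.2⟩ :=
  Subtype.ext <| InnerProductSpace.comp_rankOne _ _ _

theorem star_ketbra_mul_ketbra (hk : k ∈ S.domainVectorSubmodule k)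
    (x : S.domainVectorSubmodule k) :
    star (S.ketbra k x) * S.ketbra k x = ⟪(x : H), (x : H)⟫ • S.ketbra k ⟨k, hk⟩ :=
  Subtype.ext <| by
    change star (InnerProductSpace.rankOne ℂ (x : H) k) * InnerProductSpace.rankOne ℂ (x : H) k = _
    rw [star_eq_adjoint, InnerProductSpace.adjoint_rankOne, mul_def,
      InnerProductSpace.rankOne_comp_rankOne]
    rfl

end QuantumMarkovSemigroup

/-! ### The dissipative part and its dilation -/

theorem continuous_re_sum_inner {H : Type*} [NormedAddCommGroup H]
    [InnerProductSpace ℂ H] {ι : Type*} [Fintype ι] (M : ι → ι → H →L[ℂ] H) :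
    Continuous fun x : ι → H => (∑ i, ∑ j, ⟪M i j (x i), x j⟫).re := by
  fun_prop

theorem nonneg_of_dense {X : Type*} [TopologicalSpace X] {U : Set X} (hd : Dense U)
    {ι : Type*} {f : (ι → X) → ℝ}
    (hf : Continuous f) (h0 : ∀ x : ι → X, (∀ i, x i ∈ U) → 0 ≤ f x) (x : ι → X) : 0 ≤ f x := by
  have hsub : closure (Set.univ.pi fun _ : ι => U) ⊆ {x | 0 ≤ f x} :=
    closure_minimal (fun x hx => h0 x fun i => hx i trivial) (isClosed_le continuous_const hf)
  exact hsub (dense_pi Set.univ (fun _ _ => hd) x)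

namespace QuantumMarkovSemigroup

variable {H : Type u} [NormedAddCommGroup H] [InnerProductSpace ℂ H] [CompleteSpace H]
  {S : QuantumMarkovSemigroup H} {k : H}

variable (S) in
/-- The generator minus its Hamiltonian-type part `A ↦ G A + A G*`. -/
noncomputable def dissipativePart (G : H →L[ℂ] H) : S.domainStarSubalgebra →ₗ[ℂ] (H →L[ℂ] H) where
  toFun A := S.algebraGenerator A - (G ∘L (A : H →L[ℂ] H) + (A : H →L[ℂ] H) ∘L adjoint G)
  map_add' A B := by
    rw [map_add]
    ext x
    simp only [AddMemClass.coe_add, sub_apply, add_apply, comp_apply, map_add]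
    abel
  map_smul' c A := by
    rw [map_smul]
    ext x
    simp only [SetLike.val_smul, sub_apply, add_apply, comp_apply, smul_apply, map_smul,
      RingHom.id_apply, smul_sub, smul_add]

theorem dissipativePart_apply (G : H →L[ℂ] H) (A : S.domainStarSubalgebra) :
    S.dissipativePart G A =
      S.algebraGenerator A - (G ∘L (A : H →L[ℂ] H) + (A : H →L[ℂ] H) ∘L adjoint G) := rfl

theorem dissipativePart_star (G : H →L[ℂ] H) (A : S.domainStarSubalgebra) :
    S.dissipativePart G (star A) = star (S.dissipativePart G A) := by
  simp only [dissipativePart_apply, algebraGenerator_star, star_sub, star_add, star_eq_adjoint,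
    adjoint_comp, adjoint_adjoint, StarMemClass.coe_star]
  rw [add_comm (G ∘L _)]

/-- The shift of G₀ by -β/2, counted once in G and once in G*, contributes β⟨Ax, By⟩. Summed over
the family this is β‖u‖², the diagonal term of the adjoined pair. -/
theorem inner_dissipativePart (G₀ : H →L[ℂ] H) (β : ℝ) (A B : S.domainStarSubalgebra) (x y : H) :
    ⟪S.dissipativePart (G₀ - ((β / 2 : ℝ) : ℂ) • 1) (star B * A) x, y⟫
      = ⟪S.algebraGenerator (star B * A) x, y⟫
        - ⟪G₀ (adjoint (B : H →L[ℂ] H) ((A : H →L[ℂ] H) x)), y⟫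
        - ⟪x, G₀ (adjoint (A : H →L[ℂ] H) ((B : H →L[ℂ] H) y))⟫
        + β * ⟪(A : H →L[ℂ] H) x, (B : H →L[ℂ] H) y⟫ := by
  have h1 : ((star B * A : S.domainStarSubalgebra) : H →L[ℂ] H)
      = adjoint (B : H →L[ℂ] H) ∘L (A : H →L[ℂ] H) := rfl
  have h2 : ∀ G : H →L[ℂ] H, ⟪adjoint (B : H →L[ℂ] H) ((A : H →L[ℂ] H) (adjoint G x)), y⟫
      = ⟪x, G (adjoint (A : H →L[ℂ] H) ((B : H →L[ℂ] H) y))⟫ := fun G => by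
    rw [adjoint_inner_left, ← adjoint_inner_right (A : H →L[ℂ] H), adjoint_inner_left]
  have h3 : ∀ z : H, (1 : H →L[ℂ] H) z = z := fun _ => rfl
  rw [dissipativePart_apply, h1, sub_apply, add_apply, inner_sub_left, inner_add_left,
    comp_apply, comp_apply, comp_apply, comp_apply, h2, sub_apply, sub_apply, inner_sub_left,
    inner_sub_right, smul_apply, smul_apply, h3, h3, inner_smul_left,
    inner_smul_right, adjoint_inner_left, adjoint_inner_right, Complex.conj_ofReal]
  push_cast
  ring

variable {h : H} {G₀ : H →L[ℂ] H} {β : ℝ}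

/-- The kernel of the dissipative part of the generator is the kernel of the generator on the
family extended by `(|u⟩⟨k|, -h)`, where `u = ∑ᵢ aᵢ xᵢ`. -/
theorem sum_inner_dissipativePart_eq (hk : k ∈ S.domainVectorSubmodule k)
    (hG₀ : ∀ x : S.domainVectorSubmodule k, S.algebraGenerator (S.ketbra k x) h = G₀ x)
    (hβ : ⟪S.algebraGenerator (S.ketbra k ⟨k, hk⟩) h, h⟫ = β)
    {ι : Type*} [Fintype ι] (a : ι → S.domainStarSubalgebra) (x : ι → H)
    (u : S.domainVectorSubmodule k) (hu : (u : H) = ∑ i, (a i : H →L[ℂ] H) (x i)) :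
    ∑ i, ∑ j, ⟪S.dissipativePart (G₀ - ((β / 2 : ℝ) : ℂ) • 1) (star (a j) * a i) (x i), x j⟫
      = ∑ i : Option ι, ∑ j : Option ι,
        ⟪S.algebraGenerator (star (j.elim (S.ketbra k u) a) * i.elim (S.ketbra k u) a)
          (i.elim (-h) x), j.elim (-h) x⟫ := by
  -- Here aⱼ*|u⟩⟨k| = |aⱼ*u⟩⟨k|, so the cross terms of the adjoined pair are values of G₀.
  have h1 : ∀ j, S.algebraGenerator (star (a j) * S.ketbra k u) h
      = G₀ (adjoint (a j : H →L[ℂ] H) u) := by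
    intro j
    rw [mul_ketbra, hG₀]
    rfl
  have h2 : ∀ i y z, ⟪S.algebraGenerator (star (S.ketbra k u) * a i) y, z⟫
      = ⟪y, S.algebraGenerator (star (a i) * S.ketbra k u) z⟫ := by
    intro i y z
    rw [← star_star (a i), ← star_mul, algebraGenerator_star, star_star, star_eq_adjoint,
      adjoint_inner_left]
  simp only [Fintype.sum_option, Option.elim_none, Option.elim_some, map_neg, inner_neg_left,
    inner_neg_right, neg_neg, h1, h2, star_ketbra_mul_ketbra hk, map_smul, smul_apply,
    inner_smul_left, inner_conj_symm, hβ, inner_dissipativePart, Finset.sum_sub_distrib,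
    Finset.sum_add_distrib, ← Finset.mul_sum]
  have h3 : ∑ i, ∑ j, ⟪G₀ (adjoint (a j : H →L[ℂ] H) ((a i : H →L[ℂ] H) (x i))), x j⟫
      = ∑ j, ⟪G₀ (adjoint (a j : H →L[ℂ] H) u), x j⟫ := by
    rw [Finset.sum_comm]
    simp only [hu, map_sum, sum_inner]
  have h4 : ∑ i, ∑ j, ⟪x i, G₀ (adjoint (a i : H →L[ℂ] H) ((a j : H →L[ℂ] H) (x j)))⟫
      = ∑ i, ⟪x i, G₀ (adjoint (a i : H →L[ℂ] H) u)⟫ := by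
    simp only [hu, map_sum, inner_sum]
  have h5 : ∑ i, ∑ j, ⟪(a i : H →L[ℂ] H) (x i), (a j : H →L[ℂ] H) (x j)⟫
      = ⟪(u : H), (u : H)⟫ := by
    rw [hu, sum_inner]
    simp only [inner_sum]
  rw [h3, h4, h5, Finset.sum_neg_distrib, Finset.sum_neg_distrib]
  ring

theorem sum_apply_mem_domainVectorSubmodule {ι : Type*} (s : Finset ι)
    (a : ι → S.domainStarSubalgebra) {x : ι → H} (hx : ∀ i, x i ∈ S.domainVectorSubmodule k) :
    ∑ i ∈ s, (a i : H →L[ℂ] H) (x i) ∈ S.domainVectorSubmodule k :=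
  sum_mem fun i _ => apply_mem_domainVectorSubmodule (a i) (hx i)

theorem sum_option_apply_eq_zero (hkh : ⟪k, h⟫ = 1) {ι : Type*} [Fintype ι]
    (a : ι → S.domainStarSubalgebra) (x : ι → H) (u : S.domainVectorSubmodule k)
    (hu : (u : H) = ∑ i, (a i : H →L[ℂ] H) (x i)) :
    ∑ i : Option ι, ((i.elim (S.ketbra k u) a : S.domainStarSubalgebra) : H →L[ℂ] H)
      (i.elim (-h) x) = 0 := by
  rw [Fintype.sum_option]
  simp only [Option.elim_none, Option.elim_some, coe_ketbra, map_neg,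
    InnerProductSpace.rankOne_apply, hkh, one_smul, hu, neg_add_cancel]

theorem re_sum_inner_dissipativePart_nonneg (hk : k ∈ S.domainVectorSubmodule k)
    (hkh : ⟪k, h⟫ = 1) (hd : Dense (S.domainVectorSubmodule k : Set H))
    (hG₀ : ∀ x : S.domainVectorSubmodule k, S.algebraGenerator (S.ketbra k x) h = G₀ x)
    (hβ : ⟪S.algebraGenerator (S.ketbra k ⟨k, hk⟩) h, h⟫ = β)
    {ι : Type*} [Fintype ι] (a : ι → S.domainStarSubalgebra) (x : ι → H) :
    0 ≤ (∑ i, ∑ j, ⟪S.dissipativePart (G₀ - ((β / 2 : ℝ) : ℂ) • 1)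
      (star (a j) * a i) (x i), x j⟫).re := by
  -- For fixed aᵢ the sum is continuous in x, so the xᵢ may be taken in U; then u = ∑ aᵢ xᵢ is in U,
  -- and |u⟩⟨k| is in 𝒜.
  refine nonneg_of_dense hd (f := fun x => (∑ i, ∑ j,
    ⟪S.dissipativePart (G₀ - ((β / 2 : ℝ) : ℂ) • 1) (star (a j) * a i) (x i), x j⟫).re)
    (continuous_re_sum_inner _) (fun x hx => ?_) x
  obtain ⟨u, hu⟩ : ∃ u : S.domainVectorSubmodule k, (u : H) = ∑ i, (a i : H →L[ℂ] H) (x i) :=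
    ⟨⟨_, sum_apply_mem_domainVectorSubmodule Finset.univ a hx⟩, rfl⟩
  rw [sum_inner_dissipativePart_eq hk hG₀ hβ a x u hu]
  have h0 := sum_option_apply_eq_zero hkh a x u hu
  have h1 := S.re_sum_inner_algebraGenerator_nonneg
    (fun i : Option ι => i.elim (S.ketbra k u) a) (fun i => i.elim (-h) x) h0
  exact h1

theorem re_sum_inner_dissipativePart_mul_le (hk : k ∈ S.domainVectorSubmodule k)
    (hkh : ⟪k, h⟫ = 1) (hd : Dense (S.domainVectorSubmodule k : Set H))
    (hG₀ : ∀ x : S.domainVectorSubmodule k, S.algebraGenerator (S.ketbra k x) h = G₀ x)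
    (hβ : ⟪S.algebraGenerator (S.ketbra k ⟨k, hk⟩) h, h⟫ = β)
    {ι : Type*} [Fintype ι] (c : S.domainStarSubalgebra) (a : ι → S.domainStarSubalgebra)
    (x : ι → H) :
    (∑ i, ∑ j, ⟪S.dissipativePart (G₀ - ((β / 2 : ℝ) : ℂ) • 1)
      (star (c * a j) * (c * a i)) (x i), x j⟫).re ≤ ‖(c : H →L[ℂ] H)‖ ^ 2 *
        (∑ i, ∑ j, ⟪S.dissipativePart (G₀ - ((β / 2 : ℝ) : ℂ) • 1)
          (star (a j) * a i) (x i), x j⟫).re := by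
  rw [← sub_nonneg]
  refine nonneg_of_dense hd (f := fun x => ‖(c : H →L[ℂ] H)‖ ^ 2 *
    (∑ i, ∑ j, ⟪S.dissipativePart (G₀ - ((β / 2 : ℝ) : ℂ) • 1) (star (a j) * a i) (x i), x j⟫).re
    - (∑ i, ∑ j, ⟪S.dissipativePart (G₀ - ((β / 2 : ℝ) : ℂ) • 1)
      (star (c * a j) * (c * a i)) (x i), x j⟫).re)
    ((continuous_const.mul (continuous_re_sum_inner _)).sub (continuous_re_sum_inner _))
    (fun x hx => ?_) x
  rw [sub_nonneg]
  obtain ⟨u, hu⟩ : ∃ u : S.domainVectorSubmodule k, (u : H) = ∑ i, (a i : H →L[ℂ] H) (x i) :=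
    ⟨⟨_, sum_apply_mem_domainVectorSubmodule Finset.univ a hx⟩, rfl⟩
  -- Since c|u⟩⟨k| = |cu⟩⟨k|, multiplying the enlarged family of the aᵢ by c gives the enlarged
  -- family of the c aᵢ.
  let v : S.domainVectorSubmodule k :=
    ⟨(c : H →L[ℂ] H) u, apply_mem_domainVectorSubmodule c u.2⟩
  have hv : (v : H) = ∑ i, ((c * a i : S.domainStarSubalgebra) : H →L[ℂ] H) (x i) :=
    (congrArg (c : H →L[ℂ] H) hu).trans (map_sum (c : H →L[ℂ] H) _ _)
  rw [sum_inner_dissipativePart_eq hk hG₀ hβ a x u hu,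
    sum_inner_dissipativePart_eq hk hG₀ hβ (fun i => c * a i) x v hv]
  have helim : ∀ i : Option ι, i.elim (S.ketbra k v) (fun i => c * a i)
      = c * i.elim (S.ketbra k u) a := by
    rintro (_ | i)
    · exact (mul_ketbra c u).symm
    · rfl
  simp only [helim]
  have h0 := sum_option_apply_eq_zero hkh a x u hu
  have h1 := S.re_sum_inner_algebraGenerator_mul_le c
    (fun i : Option ι => i.elim (S.ketbra k u) a) (fun i => i.elim (-h) x) h0
  exact h1

/-- The dissipative part of the generator has a Stinespring dilation. -/
theorem exists_dilation_dissipativePart (hk : k ∈ S.domainVectorSubmodule k)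
    (hkh : ⟪k, h⟫ = 1) (hd : Dense (S.domainVectorSubmodule k : Set H))
    (hG₀ : ∀ x : S.domainVectorSubmodule k, S.algebraGenerator (S.ketbra k x) h = G₀ x)
    (hβ : ⟪S.algebraGenerator (S.ketbra k ⟨k, hk⟩) h, h⟫ = β) :
    ∃ (K : Type u) (_ : NormedAddCommGroup K) (_ : InnerProductSpace ℂ K) (_ : CompleteSpace K)
      (V : H →L[ℂ] K) (π : S.domainStarSubalgebra →⋆ₐ[ℂ] (K →L[ℂ] K)),
      (∀ A, ‖π A‖ ≤ ‖(A : H →L[ℂ] H)‖) ∧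
      ∀ A, S.dissipativePart (G₀ - ((β / 2 : ℝ) : ℂ) • 1) A = adjoint V ∘L π A ∘L V :=
  exists_stinespring_dilation (𝒜 := S.domainStarSubalgebra)
    (S.dissipativePart (G₀ - ((β / 2 : ℝ) : ℂ) • 1)) (fun A => ‖(A : H →L[ℂ] H)‖)
    (fun _ => norm_nonneg _) (dissipativePart_star _)
    (fun s x => by
      have h := re_sum_inner_dissipativePart_nonneg hk hkh hd hG₀ hβ
        (fun i : s => (i : S.domainStarSubalgebra)) (fun i => x i)
      rwa [Finset.sum_sum_coe_sort s fun a b => ⟪S.dissipativePart (G₀ - ((β / 2 : ℝ) : ℂ) • 1)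
        (star b * a) (x a), x b⟫] at h)
    (fun c s x => by
      have h := re_sum_inner_dissipativePart_mul_le hk hkh hd hG₀ hβ c
        (fun i : s => (i : S.domainStarSubalgebra)) (fun i => x i)
      rwa [Finset.sum_sum_coe_sort s fun a b => ⟪S.dissipativePart (G₀ - ((β / 2 : ℝ) : ℂ) • 1)
          (star b * a) (x a), x b⟫,
        Finset.sum_sum_coe_sort s fun a b => ⟪S.dissipativePart (G₀ - ((β / 2 : ℝ) : ℂ) • 1)
          (star (c * b) * (c * a)) (x a), x b⟫] at h)

/-- The densely defined operator `x ↦ L(|x⟩⟨k|) h` extends to a bounded operator. -/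
theorem exists_extension_algebraGenerator_ketbra
    (hd : Dense (S.domainVectorSubmodule k : Set H)) {C : ℝ}
    (hC : ∀ x : S.domainVectorSubmodule k, ‖S.algebraGenerator (S.ketbra k x) h‖ ≤ C * ‖(x : H)‖) :
    ∃ G₀ : H →L[ℂ] H, ∀ x : S.domainVectorSubmodule k,
      S.algebraGenerator (S.ketbra k x) h = G₀ x := by
  let f : S.domainVectorSubmodule k →ₗ[ℂ] H :=
    (ContinuousLinearMap.apply ℂ H h).toLinearMap ∘ₗ S.algebraGenerator ∘ₗ S.ketbra k
  refine ⟨f.extendOfNorm (S.domainVectorSubmodule k).subtype, fun x => ?_⟩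
  exact (LinearMap.extendOfNorm_eq (f := f) (e := (S.domainVectorSubmodule k).subtype)
    hd.denseRange_val ⟨C, hC⟩ x).symm

/-- |k⟩⟨k| is self-adjoint and L commutes with the adjoint. Reality of β lets it be split evenly
between G and G*. -/
theorem exists_real_eq_inner_algebraGenerator_ketbra (hk : k ∈ S.domainVectorSubmodule k)
    (h : H) : ∃ β : ℝ, ⟪S.algebraGenerator (S.ketbra k ⟨k, hk⟩) h, h⟫ = β := by
  have hs : star (S.ketbra k ⟨k, hk⟩) = S.ketbra k ⟨k, hk⟩ :=
    Subtype.ext <| InnerProductSpace.adjoint_rankOne _ _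
  have h1 := S.algebraGenerator_star (S.ketbra k ⟨k, hk⟩)
  rw [hs, star_eq_adjoint] at h1
  refine ⟨(⟪S.algebraGenerator (S.ketbra k ⟨k, hk⟩) h, h⟫).re, ?_⟩
  refine (Complex.conj_eq_iff_re.1 ?_).symm
  rw [inner_conj_symm, ← adjoint_inner_left, ← h1]

end QuantumMarkovSemigroup

/-! ### Normalization of the associate vector and conclusion -/

theorem IsAssociateVector.inner_apply_self {H : Type u} [NormedAddCommGroup H]
    [InnerProductSpace ℂ H] [CompleteSpace H] {R : H →L[ℂ] H} {h : H}
    (hh : IsAssociateVector R h) (hR : R ≠ 0) : ⟪R h, h⟫ = 1 := by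
  obtain ⟨m, k', k, t', ho, ht', hRk, hk, hh⟩ := hh
  set t := ∑ j, t' j with ht
  -- All ‖kₛ‖² equal t, so h = t^(-1/2) ∑ k'ₛ and ⟨Rh, h⟩ = t⁻¹ ∑ t'ₛ = 1; R ≠ 0 ensures t > 0.
  have htpos : 0 < t := by
    refine Finset.sum_pos (fun j _ => ht' j) (Finset.univ_nonempty_iff.2 ?_)
    by_contra hne
    rw [not_nonempty_iff] at hne
    exact hR (by rw [hRk, Finset.univ_eq_empty, Finset.sum_empty])
  have hkn : ∀ s, ‖k s‖ ^ 2 = t := fun s => by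
    rw [hk, norm_smul, ho.1 s, mul_one, Complex.norm_real, Real.norm_of_nonneg (Real.sqrt_nonneg _),
      Real.sq_sqrt htpos.le]
  have hh' : h = ∑ s, ((t⁻¹ * √t : ℝ) : ℂ) • k' s := by
    rw [hh]
    refine Finset.sum_congr rfl fun s _ => ?_
    rw [hkn, hk, smul_smul]
    push_cast
    rfl
  have hin : ∀ s, ⟪k' s, h⟫ = ((t⁻¹ * √t : ℝ) : ℂ) := fun s => by
    rw [hh', ho.inner_right_fintype]
  have hRh : R h = ∑ s, ((t' s : ℝ) : ℂ) • ((t⁻¹ * √t : ℝ) : ℂ) • k' s := by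
    rw [hRk, sum_apply]
    refine Finset.sum_congr rfl fun s _ => ?_
    rw [smul_apply, InnerProductSpace.rankOne_apply, hin]
  rw [hRh, sum_inner]
  simp only [inner_smul_left, hin, Complex.conj_ofReal]
  rw [← Finset.sum_mul]
  have h1 : t⁻¹ * √t * (t⁻¹ * √t) = t⁻¹ := by
    calc t⁻¹ * √t * (t⁻¹ * √t) = t⁻¹ * (t⁻¹ * (√t * √t)) := by ring
      _ = t⁻¹ := by rw [Real.mul_self_sqrt htpos.le, inv_mul_cancel₀ htpos.ne', mul_one]
  rw [← Complex.ofReal_mul, h1, ← Complex.ofReal_sum, ← ht, ← Complex.ofReal_mul,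
    mul_inv_cancel₀ htpos.ne', Complex.ofReal_one]

theorem proposition5p2 {H : Type u} [NormedAddCommGroup H] [InnerProductSpace ℂ H]
    [CompleteSpace H] (S : QuantumMarkovSemigroup H)
    (R : H →L[ℂ] H) (hR_pos : R.IsPositive) (hR_fin : FiniteDimensional ℂ R.range) (hR_ne : R ≠ 0)
    (hR_dom : R ∈ S.generator.domain)
    (h : H) (hh : IsAssociateVector R h)
    (hRh : InnerProductSpace.rankOne ℂ (R h) (R h) ∈ S.generator.domain)
    (hbound : ∃ C : ℝ, 0 < C ∧ ∀ (x : H) (hx : x ∈ S.domainVectors (R h)),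
      ‖S.generator ⟨InnerProductSpace.rankOne ℂ x (R h), S.rankOne_mem_domain hx⟩ h‖ ≤ C * ‖x‖)
    (hdense : Dense (S.domainVectors (R h))) :
    ∃ 𝒜 : StarSubalgebra ℂ (H →L[ℂ] H), (𝒜 : Set (H →L[ℂ] H)) = S.domainAlgebra ∧
      ∃ (G : H →L[ℂ] H) (K : Type u) (_ : NormedAddCommGroup K) (_ : InnerProductSpace ℂ K)
        (_ : CompleteSpace K) (V : H →L[ℂ] K) (π : 𝒜 →⋆ₐ[ℂ] (K →L[ℂ] K)),
        Continuous π ∧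
        (∀ (A : 𝒜) (hA : (A : H →L[ℂ] H) ∈ S.generator.domain),
          S.generator ⟨A, hA⟩ =
            adjoint V ∘L π A ∘L V + G ∘L (A : H →L[ℂ] H) + (A : H →L[ℂ] H) ∘L adjoint G) ∧
        IsSigmaWeaklyContinuous (𝒟 := (𝒜 : Set (H →L[ℂ] H)))
          (fun A => G ∘L (A : H →L[ℂ] H) + (A : H →L[ℂ] H) ∘L adjoint G) ∧
        IsSigmaWeaklyClosable (𝒟 := (𝒜 : Set (H →L[ℂ] H)))
          (fun A => adjoint V ∘L π A ∘L V) := by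
  have hk : R h ∈ S.domainVectorSubmodule (R h) :=
    QuantumMarkovSemigroup.self_mem_domainVectorSubmodule hRh
  have hkh := hh.inner_apply_self hR_ne
  obtain ⟨C, -, hC⟩ := hbound
  obtain ⟨G₀, hG₀⟩ := QuantumMarkovSemigroup.exists_extension_algebraGenerator_ketbra
    (S := S) (k := R h) (h := h) hdense fun x => hC x x.2
  obtain ⟨β, hβ⟩ := QuantumMarkovSemigroup.exists_real_eq_inner_algebraGenerator_ketbra hk h
  obtain ⟨K, _, _, _, V, π, hπ, hV⟩ := QuantumMarkovSemigroup.exists_dilation_dissipativePart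
    hk hkh hdense hG₀ hβ
  set G := G₀ - ((β / 2 : ℝ) : ℂ) • (1 : H →L[ℂ] H)
  have hL : ∀ A : S.domainStarSubalgebra, S.algebraGenerator A =
      adjoint V ∘L π A ∘L V + (G ∘L (A : H →L[ℂ] H) + (A : H →L[ℂ] H) ∘L adjoint G) := fun A => by
    rw [← hV, QuantumMarkovSemigroup.dissipativePart_apply, sub_add_cancel]
  refine ⟨S.domainStarSubalgebra, rfl, G, K, inferInstance, inferInstance, inferInstance, V, π,
    ?_, fun A hA => ?_, ?_, fun l hl B hA hB => ?_⟩
  · exact AddMonoidHomClass.continuous_of_bound π 1 fun A => by simpa using hπ A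
  · rw [add_assoc, ← hL]
    rfl
  · exact @Continuous.comp _ _ _ (TopologicalSpace.induced Subtype.val (sigmaWeakTopology H))
      (sigmaWeakTopology H) (sigmaWeakTopology H) _ _ (continuous_sigmaWeak_mul_add_mul_adjoint G)
      (@continuous_induced_dom _ _ Subtype.val (sigmaWeakTopology H))
  · have h1 : SigmaWeakTendsto (fun A : S.domainStarSubalgebra =>
        G ∘L (A : H →L[ℂ] H) + (A : H →L[ℂ] H) ∘L adjoint G) l 0 := by
      have h := (@Continuous.tendsto _ _ (sigmaWeakTopology H) (sigmaWeakTopology H) _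
        (continuous_sigmaWeak_mul_add_mul_adjoint G) 0).comp hA
      simp only [comp_zero, zero_comp, add_zero] at h
      exact h
    have h2 := hB.add h1
    rw [add_zero] at h2
    refine QuantumMarkovSemigroup.eq_zero_of_tendsto_generator
      S.hasGeneratorAt_algebraGenerator hA ?_
    exact (funext hL : (S.algebraGenerator : S.domainStarSubalgebra → H →L[ℂ] H) = _) ▸ h2
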